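/- Let $G$ be a finite simple graph (possibly disconnected) with vertex set $V(G)$ and edge set $E(G)$. Let $p(G)$ be the number of positive eigenvalues, counted with multiplicity, of the adjacency matrix of $G$; let $m(G)$ be the matching number of $G$, that is, the largest number of edges in a matching; and let $c(G)=|E(G)|-|V(G)|+\theta(G)$ be the cyclomatic number, where $\theta(G)$ is the number of connected components of $G$. Let $\mathcal F(G)$ be the set of edges of $G$ that join a vertex of some cycle of $G$ to a vertex outside that cycle. Then $p(G)=m(G)+c(G)$ if and only if the following three conditions all hold: (i) any two distinct cycles of $G$ have no vertex in common; (ii) each cycle of $G$ has length congruent to $1$ modulo $4$; (iii) there is a maximum matching $M$ of $G$ (a matching with $m(G)$ edges) such that $M\cap\mathcal F(G)=\emptyset$. -/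

import Mathlib

namespace GraphInertia

/-- The positive inertia index `p(G)`: the number of positive eigenvalues, counted with
multiplicity, of the real adjacency matrix of `G`. -/
noncomputable def posInertia {V : Type*} [Fintype V] [DecidableEq V] (G : SimpleGraph V)
    [DecidableRel G.Adj] : ℕ :=
  Fintype.card {i : V // 0 < (G.isHermitian_adjMatrix ℝ).eigenvalues i}

/-- A matching of maximum cardinality (number of edges). -/
def IsMaximumMatching {V : Type*} {G : SimpleGraph V} (M : G.Subgraph) : Prop :=
  M.IsMatching ∧ ∀ M' : G.Subgraph, M'.IsMatching → M'.edgeSet.ncard ≤ M.edgeSet.ncard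

/-- The matching number `m(G)`: the largest number of edges in a matching of `G`. For a finite
graph the set below is nonempty and bounded. -/
noncomputable def matchingNumber {V : Type*} (G : SimpleGraph V) : ℕ :=
  sSup {k : ℕ | ∃ M : G.Subgraph, M.IsMatching ∧ M.edgeSet.ncard = k}

/-- The cyclomatic number `c(G) = |E(G)| - |V(G)| + θ(G)` of a finite graph, where `θ(G)` is the
number of connected components. It is computed in the integers. -/
noncomputable def cyclomaticNumber {V : Type*} (G : SimpleGraph V) : ℤ :=
  (G.edgeSet.ncard : ℤ) - (Nat.card V : ℤ) + (Nat.card G.ConnectedComponent : ℤ)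

/-- The subgraph `C` of `G` is a cycle of `G`: it is traced out by some closed walk that is a
cycle (so base point and orientation do not matter). Its length is its number of vertices. -/
def IsCycleOf {V : Type*} (G : SimpleGraph V) (C : G.Subgraph) : Prop :=
  ∃ (v : V) (w : G.Walk v v), w.IsCycle ∧ w.toSubgraph = C

/-- The set `𝓕(G)` of edges of `G` that join a vertex of some cycle of `G` to a vertex outside
that cycle. -/
def cycleLeavingEdges {V : Type*} (G : SimpleGraph V) : Set (Sym2 V) :=
  {e | e ∈ G.edgeSet ∧ ∃ C : G.Subgraph, IsCycleOf G C ∧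
    ∃ x ∈ C.verts, ∃ y ∉ C.verts, e = s(x, y)}

end GraphInertia

/-!
Write `p`, `q` for the numbers of positive and negative eigenvalues of the adjacency matrix `A`,
realised as largest dimensions of subspaces on which the quadratic form of `A` is definite
(`posIdx`). Vertices are deleted by deleting their edges, so that all graphs live on one vertex
type.

*Upper bound.* A nonzero term of a principal minor of `A` on a vertex set `S` is a permutation `σ`
with support `S` that moves vertices along edges (`AdjPerm`). It consists of edges and cycles of
`G`, and choosing every other edge of each of its cycles gives a matching of size at least
`(#S - s) / 2`, with `s` the number of odd cycles (`AdjPerm.exists_matching`). Since `A` has a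
nonsingular principal block of size `rank A = p + q`, a forest has `p + q ≤ 2 m`; being bipartite
it has `p = q`, so `p ≤ m`. Deleting a vertex of a cycle lowers `p` by at most one and `c` by at
least one, whence `p ≤ m + c` in general.

*Necessity.* If `p = m + c`, all these inequalities are equalities. Deleting a vertex where two
cycles branch would lower `c` by two, so the cycles are disjoint (`Extremal.disjoint_cycles`).
Deleting cycle vertices down to a forest shows `q ≥ m`, so some nonzero principal minor has size
at least `2 m + c`; a permutation contributing to it has at most `c` odd cycles, hence uses all
cycles of `G` and yields a maximum matching whose edges do not leave cycles
(`Extremal.exists_matching`). For the lengths, one may delete all cycles but one, of length `ℓ`.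
All terms of that minor then have sign `(-1) ^ k` with `2 m + 1 = 2 k + ℓ`, and the sign of the minor
is `(-1) ^ q = (-1) ^ m`; so `ℓ ≡ 1` modulo `4` (`Extremal.card_mod_four`).

*Sufficiency.* Given the matching `M`, each cycle has exactly one unmatched vertex. For a set `T` of
cycles consider the minor on the vertices of `M` and of the cycles in `T`. By counting as above,
every term has exactly `#T` odd cycles and therefore sign `(-1) ^ m`
(`IsGoodMatching.sign_eq`), and there is a nonzero term: rotate the cycles in `T` and exchange
matched vertices elsewhere. Adding a cycle to `T` enlarges the block by one vertex, which changes
its negative index by at most one, and not at all because the sign of the determinant is the same.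
For `T = ∅` the block belongs to a forest, with negative index at most `m`. With all cycles in `T`
the block has size `2 m + #T` and negative index at most `m`, so `p ≥ m + #T ≥ m + c`.
-/

set_option linter.unusedSectionVars false

/-! ### Inertia indices of real symmetric matrices -/


namespace GraphInertia

open Matrix

variable {V : Type*} [Fintype V] [DecidableEq V]

/-- The positive index of a real square matrix `A`: the largest dimension of a subspace on which
the quadratic form `x ↦ xᵀ A x` is positive definite. The negative index of `A` is
`posIdx (-A)`. -/
noncomputable def posIdx (A : Matrix V V ℝ) : ℕ := sigPos A.toQuadraticForm'

lemma toQuadraticForm'_apply (A : Matrix V V ℝ) (x : V → ℝ) :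
    A.toQuadraticForm' x = x ⬝ᵥ A *ᵥ x := by
  simp [Matrix.toQuadraticForm', toLinearMap₂'_apply']

lemma le_posIdx {A : Matrix V V ℝ} (W : Submodule ℝ (V → ℝ))
    (hW : ∀ x ∈ W, x ≠ 0 → 0 < x ⬝ᵥ A *ᵥ x) : Module.finrank ℝ W ≤ posIdx A := by
  refine le_sigPos_of_posDef _ ?_
  intro x hx
  rw [QuadraticMap.restrict_apply, toQuadraticForm'_apply]
  exact hW x x.2 (by simpa using hx)

lemma exists_finrank_eq_posIdx (A : Matrix V V ℝ) :
    ∃ W : Submodule ℝ (V → ℝ), Module.finrank ℝ W = posIdx A ∧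
      ∀ x ∈ W, x ≠ 0 → 0 < x ⬝ᵥ A *ᵥ x := by
  obtain ⟨W, h, hW⟩ := exists_finrank_eq_sigPos_and_posDef A.toQuadraticForm'
  refine ⟨W, h, fun x hx hx0 => ?_⟩
  have := hW ⟨x, hx⟩ (by simpa using hx0)
  rwa [QuadraticMap.restrict_apply, toQuadraticForm'_apply] at this

/-- Comparison of positive indices: if `xᵀ A x ≤ (L x)ᵀ B (L x)` on the coordinate subspace of
vectors vanishing on `T`, then the positive index of `A` exceeds that of `B` by at most `#T`.
Interlacing, monotonicity and congruence are all special cases. -/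
lemma posIdx_le_add_card {A B : Matrix V V ℝ} (L : (V → ℝ) →ₗ[ℝ] (V → ℝ)) (T : Finset V)
    (h : ∀ x : V → ℝ, (∀ i ∈ T, x i = 0) → x ⬝ᵥ A *ᵥ x ≤ L x ⬝ᵥ B *ᵥ L x) :
    posIdx A ≤ posIdx B + T.card := by
  obtain ⟨W, hWd, hW⟩ := exists_finrank_eq_posIdx A
  obtain ⟨f, hf⟩ : ∃ f : W →ₗ[ℝ] (T → ℝ), ∀ y i, f y i = (y : V → ℝ) i :=
    ⟨(LinearMap.funLeft ℝ ℝ (fun i : T => (i : V))) ∘ₗ W.subtype, fun _ _ => rfl⟩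
  have hker := LinearMap.finrank_range_add_finrank_ker f
  have hran : Module.finrank ℝ (LinearMap.range f) ≤ T.card := by
    simpa using Submodule.finrank_le (LinearMap.range f)
  obtain ⟨K, hK, hKd⟩ : ∃ K : Submodule ℝ (V → ℝ), (∀ x ∈ K, x ∈ W ∧ ∀ i ∈ T, x i = 0) ∧
      Module.finrank ℝ K = Module.finrank ℝ (LinearMap.ker f) := by
    refine ⟨(LinearMap.ker f).map W.subtype, ?_, Submodule.finrank_map_subtype_eq _ _⟩
    rintro _ ⟨y, hy, rfl⟩
    refine ⟨y.2, fun i hi => ?_⟩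
    rw [Submodule.subtype_apply, ← hf _ ⟨i, hi⟩, LinearMap.mem_ker.1 hy, Pi.zero_apply]
  have key : ∀ x ∈ K, x ≠ 0 → 0 < L x ⬝ᵥ B *ᵥ L x := fun x hx hx0 =>
    (hW x (hK x hx).1 hx0).trans_le (h x (hK x hx).2)
  have hinj : Function.Injective (L.domRestrict K) := by
    rw [← LinearMap.ker_eq_bot, LinearMap.ker_eq_bot']
    intro y hy
    by_contra hne
    have := key y y.2 (by simpa using hne)
    rw [LinearMap.domRestrict_apply] at hy
    simp [hy] at this
  have hle : Module.finrank ℝ (LinearMap.range (L.domRestrict K)) ≤ posIdx B := by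
    refine le_posIdx _ ?_
    rintro _ ⟨y, rfl⟩ hy
    exact key y y.2 (by rintro h0; simp [h0] at hy)
  rw [LinearMap.finrank_range_of_inj hinj] at hle
  omega

lemma posIdx_le_of_forall_le {A B : Matrix V V ℝ} (L : (V → ℝ) →ₗ[ℝ] (V → ℝ))
    (h : ∀ x : V → ℝ, x ⬝ᵥ A *ᵥ x ≤ L x ⬝ᵥ B *ᵥ L x) : posIdx A ≤ posIdx B := by
  simpa using posIdx_le_add_card L ∅ (fun x _ => h x)

lemma posIdx_of_diagonalization {A U : Matrix V V ℝ} (d : V → ℝ) (hU : U * Uᵀ = 1)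
    (hA : A = U * diagonal d * Uᵀ) : posIdx A = {i | 0 < d i}.ncard := by
  refine QuadraticForm.sigPos_of_equiv_weightedSumSquares ⟨⟨Matrix.toLin'OfInv
    (M := U) (M' := Uᵀ) hU (mul_eq_one_comm.1 hU), ?_⟩⟩
  intro x
  rw [toQuadraticForm'_apply, hA, ← mulVec_mulVec, ← mulVec_mulVec, dotProduct_mulVec,
    ← mulVec_transpose]
  simp [QuadraticMap.weightedSumSquares_apply, dotProduct, mulVec_diagonal]
  exact Finset.sum_congr rfl fun i _ => by ring

lemma posIdx_eq_ncard {A : Matrix V V ℝ} (hA : A.IsHermitian) :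
    posIdx A = {i | 0 < hA.eigenvalues i}.ncard ∧
      posIdx (-A) = {i | hA.eigenvalues i < 0}.ncard := by
  have h := hA.spectral_theorem
  rw [Unitary.conjStarAlgAut_apply] at h
  have hU := Unitary.mul_star_self_of_mem hA.eigenvectorUnitary.2
  have hd : (RCLike.ofReal ∘ hA.eigenvalues : V → ℝ) = hA.eigenvalues := by ext; simp
  rw [hd, ← Unitary.coe_star] at h
  rw [star_eq_conjTranspose, conjTranspose_eq_transpose_of_trivial] at hU
  have hs : ((star hA.eigenvectorUnitary : unitaryGroup V ℝ) : Matrix V V ℝ) =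
      (hA.eigenvectorUnitary : Matrix V V ℝ)ᵀ := by
    rw [Unitary.coe_star, star_eq_conjTranspose, conjTranspose_eq_transpose_of_trivial]
  rw [hs] at h
  refine ⟨posIdx_of_diagonalization _ hU h, ?_⟩
  rw [posIdx_of_diagonalization (A := -A) (-hA.eigenvalues) hU]
  · simp
  · have : diagonal (-hA.eigenvalues) = -diagonal hA.eigenvalues := (diagonal_neg _).symm
    rw [this, mul_neg, neg_mul, ← h]

lemma posIdx_eq_card {A : Matrix V V ℝ} (hA : A.IsHermitian) :
    posIdx A = Fintype.card {i // 0 < hA.eigenvalues i} := by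
  rw [(posIdx_eq_ncard hA).1, ← Nat.card_eq_fintype_card]
  rfl

lemma posIdx_add_posIdx_neg {A : Matrix V V ℝ} (hA : A.IsHermitian) :
    posIdx A + posIdx (-A) = A.rank := by
  rw [(posIdx_eq_ncard hA).1, (posIdx_eq_ncard hA).2, hA.rank_eq_card_non_zero_eigs,
    ← Set.ncard_union_eq, ← Nat.card_eq_fintype_card, ← Nat.card_coe_set_eq]
  · refine congrArg (fun s : Set V => Nat.card s) (Set.ext fun i => ?_)
    change (_ ∨ _) ↔ _ ≠ _
    constructor
    · rintro (h | h)
      exacts [h.ne', h.ne]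
    · intro h
      exact (lt_or_gt_of_ne h).symm
  · rw [Set.disjoint_left]
    intro i hi hi'
    exact lt_asymm (show 0 < hA.eigenvalues i from hi) (show hA.eigenvalues i < 0 from hi')

lemma det_mul_neg_one_pow_pos {A : Matrix V V ℝ} (hA : A.IsHermitian) (h : A.det ≠ 0) :
    0 < A.det * (-1) ^ posIdx (-A) := by
  rw [hA.det_eq_prod_eigenvalues] at h ⊢
  have h0 : ∀ i, hA.eigenvalues i ≠ 0 := fun i => by
    have := Finset.prod_ne_zero_iff.1 h i (Finset.mem_univ i)
    simpa using this
  rw [(posIdx_eq_ncard hA).2]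
  have : (-1 : ℝ) ^ {i | hA.eigenvalues i < 0}.ncard =
      ∏ i, if hA.eigenvalues i < 0 then -1 else 1 := by
    rw [Finset.prod_ite, Finset.prod_const, Finset.prod_const_one, mul_one,
      Set.ncard_eq_toFinset_card']
    simp
  rw [this, ← Finset.prod_mul_distrib]
  refine Finset.prod_pos fun i _ => ?_
  rcases lt_or_gt_of_ne (h0 i) with hi | hi
  · simp [hi]
  · simp [hi, not_lt.2 hi.le]

lemma even_iff_even_of_mul_neg_one_pow_pos {d : ℝ} {k m : ℕ} (hk : 0 < d * (-1) ^ k)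
    (hm : 0 < d * (-1) ^ m) : Even k ↔ Even m := by
  rcases Nat.even_or_odd m with h | h <;> rcases Nat.even_or_odd k with h' | h' <;>
    rw [h.neg_one_pow] at hm <;> rw [h'.neg_one_pow] at hk
  · simp [h, h']
  · linarith
  · linarith
  · simp [← Nat.not_odd_iff_even, h, h']

/-! ### Principal blocks -/

/-- The principal block of `A` on `S`, padded by the identity outside `S`, so that all blocks of
`A` are matrices of the same size and the determinant is the principal minor on `S`. -/
def principalBlock (A : Matrix V V ℝ) (S : Finset V) : Matrix V V ℝ :=
  Matrix.of fun i j => if i ∈ S ∧ j ∈ S then A i j else if i = j then 1 else 0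

lemma principalBlock_isHermitian {A : Matrix V V ℝ} (hA : A.IsHermitian) (S : Finset V) :
    (principalBlock A S).IsHermitian := by
  ext i j
  have := hA.apply i j
  simp only [star_trivial] at this
  simp only [conjTranspose_apply, star_trivial, principalBlock, of_apply, this, and_comm, eq_comm]

/-- Restriction of a vector to the coordinates in `S`. -/
def restrictCoords (S : Finset V) : (V → ℝ) →ₗ[ℝ] (V → ℝ) where
  toFun x i := if i ∈ S then x i else 0
  map_add' x y := by ext i; by_cases h : i ∈ S <;> simp [h]
  map_smul' c x := by ext i; by_cases h : i ∈ S <;> simp [h]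

lemma restrictCoords_apply (S : Finset V) (x : V → ℝ) (i : V) :
    restrictCoords S x i = if i ∈ S then x i else 0 := rfl

lemma principalBlock_mulVec (A : Matrix V V ℝ) (S : Finset V) (x : V → ℝ) (i : V) :
    (principalBlock A S *ᵥ x) i = if i ∈ S then (A *ᵥ restrictCoords S x) i else x i := by
  simp only [mulVec, dotProduct, principalBlock, of_apply, restrictCoords_apply]
  by_cases hi : i ∈ S
  · simp only [hi, true_and, if_true]
    refine Finset.sum_congr rfl fun j _ => ?_
    by_cases hj : j ∈ S
    · simp [hj]
    · have : i ≠ j := fun h => hj (h ▸ hi)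
      simp [hj, this]
  · simp [hi]

lemma principalBlock_form (A : Matrix V V ℝ) (S : Finset V) (x : V → ℝ) :
    x ⬝ᵥ principalBlock A S *ᵥ x =
      restrictCoords S x ⬝ᵥ A *ᵥ restrictCoords S x + ∑ i ∈ Sᶜ, x i ^ 2 := by
  have : ∑ i ∈ Sᶜ, x i ^ 2 = ∑ i, if i ∈ S then 0 else x i ^ 2 := by
    rw [Finset.sum_ite, Finset.sum_const_zero, zero_add]
    congr 1
    ext; simp
  rw [this]
  simp only [dotProduct, principalBlock_mulVec]
  rw [← Finset.sum_add_distrib]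
  refine Finset.sum_congr rfl fun i _ => ?_
  by_cases hi : i ∈ S <;> simp [hi, restrictCoords_apply, sq]

lemma restrictCoords_eq_self {S : Finset V} {x : V → ℝ} (h : ∀ i ∈ Sᶜ, x i = 0) :
    restrictCoords S x = x := by
  ext i
  by_cases hi : i ∈ S
  · simp [restrictCoords_apply, hi]
  · simp [restrictCoords_apply, hi, h i (by simpa using hi)]

lemma posIdx_principalBlock_le (A : Matrix V V ℝ) (S : Finset V) :
    posIdx (principalBlock A S) ≤ posIdx A + Sᶜ.card := by
  refine posIdx_le_add_card LinearMap.id _ fun x hx => ?_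
  rw [principalBlock_form, restrictCoords_eq_self hx, Finset.sum_eq_zero]
  · simp
  · intro i hi
    simp [hx i hi]

lemma posIdx_neg_principalBlock_le (A : Matrix V V ℝ) (S : Finset V) :
    posIdx (-principalBlock A S) ≤ posIdx (-A) := by
  refine posIdx_le_of_forall_le (restrictCoords S) fun x => ?_
  rw [neg_mulVec, dotProduct_neg, principalBlock_form, neg_mulVec, dotProduct_neg]
  have : 0 ≤ ∑ i ∈ Sᶜ, x i ^ 2 := Finset.sum_nonneg fun i _ => sq_nonneg _
  linarith

lemma restrictCoords_insert {S : Finset V} {z : V} {x : V → ℝ} (hx : x z = 0) :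
    restrictCoords (insert z S) x = restrictCoords S x := by
  ext i
  by_cases hi : i = z
  · subst hi; simp [restrictCoords_apply, hx]
  · simp [restrictCoords_apply, hi]

lemma principalBlock_insert_form (A : Matrix V V ℝ) {S : Finset V} {z : V} {x : V → ℝ}
    (hx : x z = 0) :
    x ⬝ᵥ principalBlock A (insert z S) *ᵥ x = x ⬝ᵥ principalBlock A S *ᵥ x := by
  rw [principalBlock_form, principalBlock_form, restrictCoords_insert hx]
  congr 1
  refine Finset.sum_subset (Finset.compl_subset_compl.2 (Finset.subset_insert _ _)) ?_
  intro i hi hi'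
  have : i = z := by
    by_contra hne
    simp only [Finset.mem_compl, Finset.mem_insert, not_not] at hi hi'
    exact hi'.elim hne hi
  simp [this, hx]

/-- Enlarging the block by one index changes the negative index by at most one; so if both
minors are nonzero and of the same sign, it does not change. -/
lemma posIdx_neg_principalBlock_insert_le {A : Matrix V V ℝ} (hA : A.IsHermitian) {S : Finset V}
    {z : V} {m : ℕ} (h₁ : 0 < (principalBlock A S).det * (-1) ^ m)
    (h₂ : 0 < (principalBlock A (insert z S)).det * (-1) ^ m)
    (hm : posIdx (-principalBlock A S) ≤ m) :
    posIdx (-principalBlock A (insert z S)) ≤ m := by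
  have hle : posIdx (-principalBlock A (insert z S)) ≤ posIdx (-principalBlock A S) + 1 := by
    have := posIdx_le_add_card (A := -principalBlock A (insert z S)) (B := -principalBlock A S)
      LinearMap.id {z} fun x hx => by
        have hz : x z = 0 := hx z (by simp)
        simp [neg_mulVec, principalBlock_insert_form A hz]
    simpa using this
  have parity : ∀ S', 0 < (principalBlock A S').det * (-1) ^ m →
      (Even (posIdx (-principalBlock A S')) ↔ Even m) := by
    intro S' h
    have hne : (principalBlock A S').det ≠ 0 := by rintro h0; simp [h0] at h
    exact even_iff_even_of_mul_neg_one_pow_pos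
      (det_mul_neg_one_pow_pos (principalBlock_isHermitian hA S') hne) h
  have e₁ := parity _ h₁
  have e₂ := parity _ h₂
  generalize posIdx (-principalBlock A (insert z S)) = k' at *
  generalize posIdx (-principalBlock A S) = k at *
  rcases hm.lt_or_eq with hlt | heq
  · omega
  · by_contra hcon
    have : k' = k + 1 := by omega
    rw [this, Nat.even_add_one, e₁] at e₂
    tauto

/-- A symmetric matrix has a nonsingular principal block of size equal to its rank: take a set of
indices whose rows form a basis of the row space. -/
lemma exists_principalBlock_det_ne_zero {A : Matrix V V ℝ} (hA : A.IsHermitian) :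
    ∃ S : Finset V, S.card = A.rank ∧ (principalBlock A S).det ≠ 0 := by
  obtain ⟨κ, a, ha, hspan, hli⟩ := exists_linearIndependent' ℝ A.row
  have : Finite κ := Finite.of_injective a ha
  have := Fintype.ofFinite κ
  have hsymm : ∀ i j, A i j = A j i := fun i j => by simpa using (hA.apply i j).symm
  refine ⟨Finset.univ.image a, ?_, ?_⟩
  · rw [Finset.card_image_of_injective _ ha, A.rank_eq_finrank_span_row, ← hspan,
      finrank_span_eq_card hli, Finset.card_univ]
  · intro hdet
    obtain ⟨x, hx0, hx⟩ := exists_mulVec_eq_zero_iff.2 hdet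
    set S := Finset.univ.image a with hS
    have hoff : ∀ i ∈ Sᶜ, x i = 0 := fun i hi => by
      have := congrFun hx i
      rw [principalBlock_mulVec, if_neg (by simpa using hi)] at this
      simpa using this
    have hon : ∀ i ∈ S, (A *ᵥ x) i = 0 := fun i hi => by
      have := congrFun hx i
      rw [principalBlock_mulVec, if_pos hi, restrictCoords_eq_self hoff] at this
      simpa using this
    -- The annihilator of `x` contains the rows in `S`, hence the whole row space.
    have hall : ∀ v ∈ Submodule.span ℝ (Set.range A.row), v ⬝ᵥ x = 0 := by
      rw [← hspan]
      intro v hv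
      induction hv using Submodule.span_induction with
      | mem v hv =>
        obtain ⟨k, rfl⟩ := hv
        exact hon (a k) (Finset.mem_image_of_mem _ (Finset.mem_univ k))
      | zero => simp
      | add u v _ _ hu hv => rw [add_dotProduct, hu, hv, add_zero]
      | smul c v _ hv => rw [smul_dotProduct, hv, smul_zero]
    have hrows : ∑ k, x (a k) • A.row (a k) = 0 := by
      ext i
      have h1 := hall (A.row i) (Submodule.subset_span ⟨i, rfl⟩)
      have h2 : ∑ k, x (a k) * A (a k) i = ∑ j, A i j * x j := by
        rw [← Finset.sum_subset (Finset.subset_univ S), hS,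
          Finset.sum_image (fun _ _ _ _ h => ha h)]
        · exact Finset.sum_congr rfl fun k _ => by rw [hsymm, mul_comm]
        · intro j _ hj
          rw [hoff j (by simpa using hj), mul_zero]
      simp only [Finset.sum_apply, Pi.smul_apply, smul_eq_mul, Pi.zero_apply, row]
      rw [h2]
      simpa [dotProduct] using h1
    have hk := Fintype.linearIndependent_iff.1 hli (fun k => x (a k)) hrows
    refine hx0 (funext fun i => ?_)
    by_cases hi : i ∈ S
    · obtain ⟨k, -, rfl⟩ := Finset.mem_image.1 hi
      exact hk k
    · exact hoff i (by simpa using hi)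

end GraphInertia

namespace GraphInertia

/-! ### The cyclomatic number -/

section Cyclomatic

open SimpleGraph

variable {V : Type*} {G : SimpleGraph V}

/-- Connectivity after deleting an edge `xy`: two vertices connected in `G` are still connected,
or each of them is connected to an end of the deleted edge. -/
lemma reachable_deleteEdges_or {x y u v : V} (h : G.Reachable u v) :
    (G.deleteEdges {s(x, y)}).Reachable u v ∨
      (((G.deleteEdges {s(x, y)}).Reachable u x ∨ (G.deleteEdges {s(x, y)}).Reachable u y) ∧
        ((G.deleteEdges {s(x, y)}).Reachable v x ∨ (G.deleteEdges {s(x, y)}).Reachable v y)) := by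
  obtain ⟨p⟩ := h
  induction p with
  | nil => exact Or.inl (Reachable.refl _)
  | @cons u w v hadj p ih =>
    by_cases he : s(u, w) = s(x, y)
    · right
      rw [Sym2.eq_iff] at he
      rcases he with ⟨rfl, rfl⟩ | ⟨rfl, rfl⟩ <;> refine ⟨by simp, ?_⟩ <;>
        rcases ih with h | h
      · exact Or.inr h.symm
      · exact h.2
      · exact Or.inl h.symm
      · exact h.2
    · have hu : (G.deleteEdges {s(x, y)}).Reachable u w := by
        refine Adj.reachable ?_
        rw [deleteEdges_adj]
        exact ⟨hadj, he⟩
      rcases ih with h | ⟨h, h'⟩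
      · exact Or.inl (hu.trans h)
      · exact Or.inr ⟨h.imp hu.trans hu.trans, h'⟩

variable [Finite V]

lemma ncard_edgeSet_deleteEdges {x y : V} (h : G.Adj x y) :
    (G.deleteEdges {s(x, y)}).edgeSet.ncard + 1 = G.edgeSet.ncard := by
  rw [edgeSet_deleteEdges]
  exact Set.ncard_sdiff_singleton_add_one (by simpa using h) (Set.toFinite _)

lemma card_component_deleteEdges_le (x y : V) :
    Nat.card (G.deleteEdges {s(x, y)}).ConnectedComponent ≤ Nat.card G.ConnectedComponent + 1 := by
  classical
  have hle := G.deleteEdges_le {s(x, y)}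
  rw [← Finite.card_option]
  refine Nat.card_le_card_of_injective (fun c : (G.deleteEdges {s(x, y)}).ConnectedComponent =>
    if c = connectedComponentMk _ x then none else some (c.map (Hom.ofLE hle))) ?_
  intro c₁ c₂ h
  induction c₁ using ConnectedComponent.ind with | _ u
  induction c₂ using ConnectedComponent.ind with | _ v
  simp only [ConnectedComponent.map_mk, Hom.ofLE_apply] at h
  split_ifs at h with h₁ h₂ h₂
  · rw [h₁, h₂]
  · simp only [Option.some.injEq, ConnectedComponent.eq] at h h₁ h₂ ⊢
    rcases reachable_deleteEdges_or (x := x) (y := y) h with h | ⟨h, h'⟩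
    · exact h
    · exact (h.resolve_left h₁).trans (h'.resolve_left h₂).symm

lemma cyclomaticNumber_deleteEdges_le {x y : V} (h : G.Adj x y) :
    cyclomaticNumber (G.deleteEdges {s(x, y)}) ≤ cyclomaticNumber G := by
  have h₁ := ncard_edgeSet_deleteEdges h
  have h₂ := card_component_deleteEdges_le (G := G) x y
  unfold cyclomaticNumber
  omega

lemma cyclomaticNumber_deleteEdges_of_reachable {x y : V} (h : G.Adj x y)
    (hr : (G.deleteEdges {s(x, y)}).Reachable x y) :
    cyclomaticNumber (G.deleteEdges {s(x, y)}) = cyclomaticNumber G - 1 := by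
  have h₁ := ncard_edgeSet_deleteEdges h
  have hle := G.deleteEdges_le {s(x, y)}
  have h₂ : Nat.card (G.deleteEdges {s(x, y)}).ConnectedComponent =
      Nat.card G.ConnectedComponent := by
    refine le_antisymm (Nat.card_le_card_of_injective
      (fun c => c.map (Hom.ofLE hle)) ?_) (ConnectedComponent.card_le_card_of_le hle)
    intro c₁ c₂ h
    induction c₁ using ConnectedComponent.ind with | _ u
    induction c₂ using ConnectedComponent.ind with | _ v
    simp only [ConnectedComponent.map_mk, Hom.ofLE_apply, ConnectedComponent.eq] at h ⊢
    rcases reachable_deleteEdges_or (x := x) (y := y) h with h | ⟨h, h'⟩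
    · exact h
    · have hu := h.elim id fun h => h.trans hr.symm
      have hv := h'.elim id fun h => h.trans hr.symm
      exact hu.trans hv.symm
  unfold cyclomaticNumber
  omega

lemma cyclomaticNumber_le_deleteEdges {x y : V} (h : G.Adj x y)
    (hr : ¬ (G.deleteEdges {s(x, y)}).Reachable x y) :
    cyclomaticNumber G ≤ cyclomaticNumber (G.deleteEdges {s(x, y)}) := by
  have h₁ := ncard_edgeSet_deleteEdges h
  have hle := G.deleteEdges_le {s(x, y)}
  have h₂ : Nat.card G.ConnectedComponent <
      Nat.card (G.deleteEdges {s(x, y)}).ConnectedComponent := by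
    by_contra hcon
    have hb := (ConnectedComponent.surjective_map_ofLE hle).bijective_of_nat_card_le
      (not_lt.1 hcon)
    refine hr (ConnectedComponent.eq.1 (hb.injective ?_))
    simpa using h.reachable
  unfold cyclomaticNumber
  omega

lemma exists_adj_not_adj_of_lt {H : SimpleGraph V} (h : H ≤ G) (hne : H ≠ G) :
    ∃ x y, G.Adj x y ∧ ¬ H.Adj x y := by
  by_contra! hcon
  exact hne (le_antisymm h fun x y => hcon x y)

lemma cyclomaticNumber_mono {H : SimpleGraph V} (h : H ≤ G) :
    cyclomaticNumber H ≤ cyclomaticNumber G := by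
  induction hn : G.edgeSet.ncard using Nat.strong_induction_on generalizing G with
  | _ n ih =>
    by_cases hne : H = G
    · rw [hne]
    · obtain ⟨x, y, hG, hH⟩ := exists_adj_not_adj_of_lt h hne
      have hc := ncard_edgeSet_deleteEdges hG
      have hle : H ≤ G.deleteEdges {s(x, y)} := by
        intro a b hab
        rw [deleteEdges_adj]
        refine ⟨h hab, fun he => hH ?_⟩
        rw [← mem_edgeSet, ← Set.mem_singleton_iff.1 he]
        exact hab
      exact (ih _ (by omega) hle rfl).trans (cyclomaticNumber_deleteEdges_le hG)

lemma cyclomaticNumber_bot : cyclomaticNumber (⊥ : SimpleGraph V) = 0 := by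
  have : Nat.card (⊥ : SimpleGraph V).ConnectedComponent = Nat.card V := by
    refine (Nat.card_eq_of_bijective (connectedComponentMk ⊥) ⟨fun u v h => ?_, ?_⟩).symm
    · simpa using h
    · intro c
      induction c using ConnectedComponent.ind with | _ u
      exact ⟨u, rfl⟩
  simp [cyclomaticNumber, this]

lemma cyclomaticNumber_nonneg : 0 ≤ cyclomaticNumber G :=
  cyclomaticNumber_bot (V := V) ▸ cyclomaticNumber_mono bot_le

lemma cyclomaticNumber_of_isAcyclic (hG : G.IsAcyclic) : cyclomaticNumber G = 0 := by
  refine le_antisymm ?_ cyclomaticNumber_nonneg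
  induction hn : G.edgeSet.ncard using Nat.strong_induction_on generalizing G with
  | _ n ih =>
    by_cases hne : ⊥ = G
    · rw [← hne, cyclomaticNumber_bot]
    · obtain ⟨x, y, hadj, -⟩ := exists_adj_not_adj_of_lt bot_le hne
      have hc := ncard_edgeSet_deleteEdges hadj
      have hb := isAcyclic_iff_forall_adj_isBridge.1 hG hadj
      exact (cyclomaticNumber_le_deleteEdges hadj (isBridge_iff.1 hb)).trans
        (ih _ (by omega) (hG.anti (G.deleteEdges_le _)) rfl)

lemma cyclomaticNumber_deleteEdges_of_mem_cycle {u x y : V} {w : G.Walk u u} (hw : w.IsCycle)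
    (he : s(x, y) ∈ w.edges) :
    cyclomaticNumber (G.deleteEdges {s(x, y)}) = cyclomaticNumber G - 1 := by
  obtain ⟨h, hr⟩ := adj_and_reachable_delete_edges_iff_exists_cycle.2 ⟨u, w, hw, he⟩
  exact cyclomaticNumber_deleteEdges_of_reachable h hr

lemma deleteIncidenceSet_le_deleteEdges (v d : V) :
    G.deleteIncidenceSet v ≤ G.deleteEdges {s(v, d)} := by
  intro a b h
  rw [deleteIncidenceSet_adj] at h
  rw [deleteEdges_adj]
  refine ⟨h.1, fun he => ?_⟩
  rw [Set.mem_singleton_iff, Sym2.eq_iff] at he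
  rcases he with ⟨rfl, -⟩ | ⟨-, rfl⟩
  · exact h.2.1 rfl
  · exact h.2.2 rfl

lemma cyclomaticNumber_deleteIncidenceSet_le {u v d : V} {w : G.Walk u u} (hw : w.IsCycle)
    (he : s(v, d) ∈ w.edges) :
    cyclomaticNumber (G.deleteIncidenceSet v) ≤ cyclomaticNumber G - 1 := by
  rw [← cyclomaticNumber_deleteEdges_of_mem_cycle hw he]
  exact cyclomaticNumber_mono (deleteIncidenceSet_le_deleteEdges v d)

lemma exists_mem_edges_of_mem_support {u v : V} {w : G.Walk u u} (hw : w.IsCycle)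
    (hv : v ∈ w.support) : ∃ d, s(v, d) ∈ w.edges := by
  classical
  have hr := hw.rotate hv
  refine ⟨(w.rotate v hv).snd, (w.rotate_edges v hv).mem_iff.1 ?_⟩
  exact Walk.mk_start_snd_mem_edges hr.not_nil

/-- The vertex set `S` carries a cycle of `G`. -/
def CycleOn (G : SimpleGraph V) (S : Finset V) : Prop :=
  ∃ (u : V) (w : G.Walk u u), w.IsCycle ∧ ∀ x, x ∈ w.support ↔ x ∈ S

lemma isCycle_toDeleteEdge {u : V} {e : Sym2 V} {w : G.Walk u u} (hw : w.IsCycle)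
    (he : e ∉ w.edges) : ∃ w' : (G.deleteEdges {e}).Walk u u, w'.IsCycle ∧
      w'.support = w.support ∧ w'.edges = w.edges := by
  have h : ∀ e' ∈ w.edges, e' ∈ (G.deleteEdges {e}).edgeSet := by
    intro e' he'
    rw [edgeSet_deleteEdges]
    exact ⟨w.edges_subset_edgeSet he', fun h => he (h ▸ he')⟩
  exact ⟨w.transfer _ h, hw.transfer h, w.support_transfer h, w.edges_transfer h⟩

/-- If two cycles through `v` do not use the same edges at `v`, then deleting `v` lowers the
cyclomatic number by at least two. -/
lemma cyclomaticNumber_deleteIncidenceSet_le_sub_two {u₁ u₂ v d : V} {w₁ : G.Walk u₁ u₁}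
    {w₂ : G.Walk u₂ u₂} (h₁ : w₁.IsCycle) (h₂ : w₂.IsCycle) (hv : v ∈ w₁.support)
    (he₁ : s(v, d) ∉ w₁.edges) (he₂ : s(v, d) ∈ w₂.edges) :
    cyclomaticNumber (G.deleteIncidenceSet v) ≤ cyclomaticNumber G - 2 := by
  have hc := cyclomaticNumber_deleteEdges_of_mem_cycle h₂ he₂
  obtain ⟨w, hw, hws, -⟩ := isCycle_toDeleteEdge h₁ he₁
  obtain ⟨d', hd'⟩ := exists_mem_edges_of_mem_support hw (hws ▸ hv)
  have hc' := cyclomaticNumber_deleteIncidenceSet_le hw hd'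
  have hle : G.deleteIncidenceSet v ≤ (G.deleteEdges {s(v, d)}).deleteIncidenceSet v := by
    intro a b h
    have h' := deleteIncidenceSet_le_deleteEdges v d h
    rw [deleteIncidenceSet_adj] at h ⊢
    exact ⟨h', h.2⟩
  have := cyclomaticNumber_mono hle
  omega

/-- A graph contains at most `c(G)` pairwise disjoint cycles. -/
lemma card_le_cyclomaticNumber (T : Finset (Finset V)) (hT : ∀ S ∈ T, CycleOn G S)
    (hd : ∀ S ∈ T, ∀ S' ∈ T, S ≠ S' → Disjoint S S') : (T.card : ℤ) ≤ cyclomaticNumber G := by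
  classical
  induction T using Finset.induction_on generalizing G with
  | empty => simpa using cyclomaticNumber_nonneg
  | insert S T hS ih =>
    obtain ⟨u, w, hw, hwS⟩ := hT S (Finset.mem_insert_self _ _)
    obtain ⟨d, hd'⟩ := exists_mem_edges_of_mem_support hw w.start_mem_support
    have hc := cyclomaticNumber_deleteEdges_of_mem_cycle hw hd'
    have := ih (G := G.deleteEdges {s(u, d)}) ?_ ?_
    · rw [Finset.card_insert_of_notMem hS]
      push_cast
      omega
    · intro S' hS'
      obtain ⟨u', w', hw', hwS'⟩ := hT S' (Finset.mem_insert_of_mem hS')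
      have hne : S ≠ S' := by rintro rfl; exact hS hS'
      have hdis := hd S (Finset.mem_insert_self _ _) S' (Finset.mem_insert_of_mem hS') hne
      obtain ⟨w'', h₁, h₂, -⟩ := isCycle_toDeleteEdge (e := s(u, d)) hw' fun he =>
        Finset.disjoint_left.1 hdis ((hwS u).1 w.start_mem_support)
          ((hwS' u).1 (w'.fst_mem_support_of_mem_edges he))
      exact ⟨u', w'', h₁, fun x => h₂ ▸ hwS' x⟩
    · intro S₁ h₁ S₂ h₂
      exact hd S₁ (Finset.mem_insert_of_mem h₁) S₂ (Finset.mem_insert_of_mem h₂)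

/-- A graph has at least `c(G)` cycles. -/
lemma cyclomaticNumber_le_ncard_cycles :
    cyclomaticNumber G ≤ ({C : G.Subgraph | IsCycleOf G C}.ncard : ℤ) := by
  induction hn : G.edgeSet.ncard using Nat.strong_induction_on generalizing G with
  | _ n ih =>
    by_cases hG : G.IsAcyclic
    · rw [cyclomaticNumber_of_isAcyclic hG]
      exact Int.natCast_nonneg _
    · simp only [IsAcyclic, not_forall, not_not] at hG
      obtain ⟨u, w, hw⟩ := hG
      obtain ⟨d, he⟩ := exists_mem_edges_of_mem_support hw w.start_mem_support
      have hc := cyclomaticNumber_deleteEdges_of_mem_cycle hw he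
      have hadj := w.adj_of_mem_edges he
      have hcard := ncard_edgeSet_deleteEdges hadj
      have hle := G.deleteEdges_le {s(u, d)}
      have hi := ih _ (by omega) (G := G.deleteEdges {s(u, d)}) rfl
      have hinj : Function.Injective
          (fun C : (G.deleteEdges {s(u, d)}).Subgraph => C.map (Hom.ofLE hle)) := by
        intro C C' h
        refine Subgraph.ext ?_ (funext₂ fun a b => ?_)
        · simpa using congrArg Subgraph.verts h
        · simpa [Relation.Map] using congrFun₂ (congrArg Subgraph.Adj h) a b
      -- Cycles avoiding the deleted edge survive, and the cycle `w` does not.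
      have hlt : {C : (G.deleteEdges {s(u, d)}).Subgraph | IsCycleOf _ C}.ncard <
          {C : G.Subgraph | IsCycleOf G C}.ncard := by
        rw [← Set.ncard_image_of_injective _ hinj]
        refine Set.ncard_lt_ncard ⟨?_, fun hsub => ?_⟩ (Set.toFinite _)
        · rintro _ ⟨_, ⟨v, p, hp, rfl⟩, rfl⟩
          exact ⟨v, p.mapLe hle, hp.mapLe hle, Walk.toSubgraph_map _ _⟩
        · obtain ⟨C, -, hC⟩ := hsub ⟨u, w, hw, rfl⟩
          have h1 : w.toSubgraph.Adj u d := Walk.adj_toSubgraph_iff_mem_edges.2 he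
          rw [← hC] at h1
          simp only [Subgraph.map_adj, Relation.Map, Hom.ofLE_apply] at h1
          obtain ⟨a, b, hab, rfl, rfl⟩ := h1
          have := hab.adj_sub
          simp at this
      omega

end Cyclomatic

end GraphInertia

namespace GraphInertia

/-! ### Matchings -/

section Matchings

open SimpleGraph

variable {V : Type*} [Fintype V] {G : SimpleGraph V}

lemma bddAbove_matching_sizes (G : SimpleGraph V) :
    BddAbove {k : ℕ | ∃ M : G.Subgraph, M.IsMatching ∧ M.edgeSet.ncard = k} := by
  refine ⟨G.edgeSet.ncard, ?_⟩
  rintro _ ⟨M, -, rfl⟩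
  exact Set.ncard_le_ncard M.edgeSet_subset (Set.toFinite _)

lemma ncard_le_matchingNumber {M : G.Subgraph} (hM : M.IsMatching) :
    M.edgeSet.ncard ≤ matchingNumber G :=
  le_csSup (bddAbove_matching_sizes G) ⟨M, hM, rfl⟩

lemma exists_ncard_eq_matchingNumber (G : SimpleGraph V) :
    ∃ M : G.Subgraph, M.IsMatching ∧ M.edgeSet.ncard = matchingNumber G :=
  Nat.sSup_mem (s := {k : ℕ | ∃ M : G.Subgraph, M.IsMatching ∧ M.edgeSet.ncard = k})
    ⟨_, ⊥, fun _ h => h.elim, rfl⟩ (bddAbove_matching_sizes G)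

lemma isMaximumMatching_iff {M : G.Subgraph} :
    IsMaximumMatching M ↔ M.IsMatching ∧ M.edgeSet.ncard = matchingNumber G := by
  refine ⟨fun h => ⟨h.1, le_antisymm (ncard_le_matchingNumber h.1) ?_⟩, fun h => ⟨h.1, ?_⟩⟩
  · obtain ⟨M', hM', h'⟩ := exists_ncard_eq_matchingNumber G
    exact h' ▸ h.2 M' hM'
  · exact fun M' hM' => h.2 ▸ ncard_le_matchingNumber hM'

lemma matchingNumber_mono {H : SimpleGraph V} (h : H ≤ G) :
    matchingNumber H ≤ matchingNumber G := by
  obtain ⟨M, hM, hc⟩ := exists_ncard_eq_matchingNumber H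
  rw [← hc]
  refine le_trans (le_of_eq ?_) (ncard_le_matchingNumber (hM.map_ofLE h))
  congr 1
  simp [Subgraph.edgeSet_map]

lemma ncard_edgeSet_sup {M M' : G.Subgraph} (h : Disjoint M.verts M'.verts) :
    (M ⊔ M').edgeSet.ncard = M.edgeSet.ncard + M'.edgeSet.ncard := by
  rw [Subgraph.edgeSet_sup, Set.ncard_union_eq _ (Set.toFinite _) (Set.toFinite _)]
  rw [Set.disjoint_left]
  intro e he he'
  induction e with | _ a b
  rw [Subgraph.mem_edgeSet] at he he'
  exact Set.disjoint_left.1 h he.fst_mem he'.fst_mem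

lemma isMatching_sup {M M' : G.Subgraph} (hM : M.IsMatching) (hM' : M'.IsMatching)
    (h : Disjoint M.verts M'.verts) : (M ⊔ M').IsMatching :=
  hM.sup hM' (by rwa [hM.support_eq_verts, hM'.support_eq_verts])

lemma two_mul_ncard_edgeSet {M : G.Subgraph} (hM : M.IsMatching) :
    M.verts.ncard = 2 * M.edgeSet.ncard := by
  classical
  have hv : M.verts.toFinset = M.edgeSet.toFinset.biUnion Sym2.toFinset := by
    ext v
    rw [Set.mem_toFinset, hM.verts_eq_biUnion_edgeSet]
    simp
  rw [Set.ncard_eq_toFinset_card', Set.ncard_eq_toFinset_card', hv, Finset.card_biUnion,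
    Finset.sum_const_nat (m := 2), mul_comm]
  · intro e he
    rw [Set.mem_toFinset] at he
    exact Sym2.card_toFinset_of_not_isDiag _ (G.not_isDiag_of_mem_edgeSet (M.edgeSet_subset he))
  · intro e he e' he' hne
    rw [Finset.mem_coe, Set.mem_toFinset] at he he'
    rw [Function.onFun, Finset.disjoint_left]
    intro v hv hv'
    rw [Sym2.mem_toFinset] at hv hv'
    obtain ⟨a, rfl⟩ := hv
    obtain ⟨b, rfl⟩ := hv'
    rw [Subgraph.mem_edgeSet] at he he'
    exact hne (by rw [hM.eq_of_adj_left he he'])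

/-- A matching, viewed as the involution that exchanges matched vertices. -/
lemma exists_involution_of_isMatching {M : G.Subgraph} (hM : M.IsMatching) :
    ∃ μ : Equiv.Perm V, (∀ v, μ (μ v) = v) ∧ (∀ v ∈ M.verts, M.Adj v (μ v)) ∧
      ∀ v ∉ M.verts, μ v = v := by
  classical
  let f : V → V := fun v => if h : v ∈ M.verts then (hM h).choose else v
  have h₁ : ∀ v ∈ M.verts, M.Adj v (f v) := fun v hv => by
    simp only [f, hv, dif_pos]
    exact (hM hv).choose_spec.1
  have h₂ : ∀ v ∉ M.verts, f v = v := fun v hv => by simp [f, hv]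
  have h₃ : Function.Involutive f := by
    intro v
    by_cases hv : v ∈ M.verts
    · exact hM.eq_of_adj_left (h₁ _ (h₁ v hv).snd_mem) (h₁ v hv).symm
    · rw [h₂ v hv, h₂ v hv]
  exact ⟨h₃.toPerm, h₃, h₁, h₂⟩

/-- A path on `n` vertices contains a matching with `⌊n / 2⌋` edges. -/
lemma exists_matching_of_isChain (l : List V) (hn : l.Nodup) (hc : l.IsChain G.Adj) :
    ∃ M : G.Subgraph, M.IsMatching ∧ M.verts ⊆ {v | v ∈ l} ∧
      l.length ≤ 2 * M.edgeSet.ncard + l.length % 2 := by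
  induction l using List.twoStepInduction with
  | nil => exact ⟨⊥, fun _ h => h.elim, by simp, by simp⟩
  | singleton a => exact ⟨⊥, fun _ h => h.elim, by simp, by simp⟩
  | cons_cons a b l ih _ =>
    obtain ⟨M, hM, hv, hl⟩ := ih hn.of_cons.of_cons hc.of_cons.of_cons
    have hab : G.Adj a b := hc.rel
    have hdis : Disjoint (G.subgraphOfAdj hab).verts M.verts := by
      rw [Set.disjoint_left]
      intro x hx hx'
      have hxl : x ∈ l := hv hx'
      simp only [subgraphOfAdj_verts, Set.mem_insert_iff, Set.mem_singleton_iff] at hx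
      simp only [List.nodup_cons, List.mem_cons, not_or] at hn
      rcases hx with rfl | rfl
      · exact hn.1.2 hxl
      · exact hn.2.1 hxl
    refine ⟨_, isMatching_sup (Subgraph.IsMatching.subgraphOfAdj hab) hM hdis, ?_, ?_⟩
    · rw [Subgraph.verts_sup, Set.union_subset_iff]
      constructor
      · intro x hx
        simp only [subgraphOfAdj_verts, Set.mem_insert_iff, Set.mem_singleton_iff] at hx
        rcases hx with rfl | rfl <;> simp
      · intro x hx
        exact List.mem_cons_of_mem _ (List.mem_cons_of_mem _ (hv hx))
    · rw [ncard_edgeSet_sup hdis, edgeSet_subgraphOfAdj, Set.ncard_singleton]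
      simp only [List.length_cons]
      omega

end Matchings

/-! ### Permutations moving every vertex along an edge -/

section Permutations

open SimpleGraph Equiv.Perm

variable {V : Type*} [Fintype V] [DecidableEq V] {G : SimpleGraph V}

/-- `σ` moves vertices only along edges of `G`. These are the permutations that contribute to the
principal minors of the adjacency matrix; their cycles of length two are edges of `G`, and their
longer cycles are oriented cycles of `G`. -/
def AdjPerm (G : SimpleGraph V) (σ : Equiv.Perm V) : Prop := ∀ v, σ v ≠ v → G.Adj v (σ v)

lemma AdjPerm.of_mem_cycleFactorsFinset {σ τ : Equiv.Perm V} (h : AdjPerm G σ)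
    (hτ : τ ∈ σ.cycleFactorsFinset) : AdjPerm G τ := by
  intro v hv
  have e := (mem_cycleFactorsFinset_iff.1 hτ).2 v (mem_support.2 hv)
  rw [e] at hv ⊢
  exact h v hv

lemma isChain_toList {σ : Equiv.Perm V} (h : AdjPerm G σ) {x : V} (hx : σ x ≠ x) :
    (σ.toList x).IsChain G.Adj := by
  rw [List.isChain_iff_getElem]
  intro i hi
  rw [getElem_toList, getElem_toList, pow_succ', mul_apply]
  refine h _ fun hfix => hx ?_
  rw [← mul_apply, ← pow_succ', pow_succ, mul_apply] at hfix
  exact (σ ^ i).injective hfix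

lemma length_toList_of_isCycle {τ : Equiv.Perm V} (hτ : τ.IsCycle) {x : V} (hx : τ x ≠ x) :
    (τ.toList x).length = τ.support.card := by
  rw [length_toList, hτ.cycleOf_eq hx]

lemma mem_toList_iff_of_isCycle {τ : Equiv.Perm V} (hτ : τ.IsCycle) {x y : V} (hx : τ x ≠ x) :
    y ∈ τ.toList x ↔ y ∈ τ.support := by
  rw [mem_toList_iff, Equiv.Perm.mem_support, Equiv.Perm.mem_support]
  constructor
  · rintro ⟨h, -⟩ hy
    exact hx ((h.apply_eq_self_iff).2 hy)
  · intro hy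
    exact ⟨hτ.sameCycle hx hy, hx⟩

/-- The cycles of `σ` of odd length. -/
def oddFactors (σ : Equiv.Perm V) : Finset (Equiv.Perm V) :=
  {τ ∈ σ.cycleFactorsFinset | Odd τ.support.card}

/-- Each cycle of `σ` of length `n` contains a matching with `⌊n / 2⌋` edges. Together they form
a matching whose edges stay inside the cycles of `σ`. -/
lemma AdjPerm.exists_matching {σ : Equiv.Perm V} (h : AdjPerm G σ) :
    ∃ M : G.Subgraph, M.IsMatching ∧ M.verts ⊆ {v | v ∈ σ.support} ∧
      (∀ x y, M.Adj x y → ∃ τ ∈ σ.cycleFactorsFinset, x ∈ τ.support ∧ y ∈ τ.support) ∧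
      σ.support.card ≤ 2 * M.edgeSet.ncard + (oddFactors σ).card := by
  induction σ using cycle_induction_on with
  | base_one =>
    exact ⟨⊥, fun _ h => h.elim, by simp, fun x y h => h.elim, by simp⟩
  | base_cycles σ hσ =>
    obtain ⟨x, hx, -⟩ := id hσ
    obtain ⟨M, hM, hv, hl⟩ := exists_matching_of_isChain _ (nodup_toList σ x)
      (isChain_toList h hx)
    have hv' : M.verts ⊆ {v | v ∈ σ.support} := fun v hvM =>
      (mem_toList_iff_of_isCycle hσ hx).1 (hv hvM)
    have hf : σ.cycleFactorsFinset = {σ} := hσ.cycleFactorsFinset_eq_singleton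
    refine ⟨M, hM, hv', fun a b hab => ⟨σ, by simp [hf], hv' hab.fst_mem, hv' hab.snd_mem⟩, ?_⟩
    rw [length_toList_of_isCycle hσ hx] at hl
    refine hl.trans (Nat.add_le_add_left ?_ _)
    rw [oddFactors, hf, Finset.filter_singleton]
    split_ifs with ho
    · simp [Nat.odd_iff.1 ho]
    · simp [Nat.even_iff.1 (Nat.not_odd_iff_even.1 ho)]
  | induction_disjoint σ τ hd hσ ih₁ ih₂ =>
    have hfac := hd.cycleFactorsFinset_mul_eq_union
    have h₁ : AdjPerm G σ := fun v hv => by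
      have := h v
      rw [mul_apply, (hd v).resolve_left hv] at this
      exact this hv
    have h₂ : AdjPerm G τ := fun v hv => by
      have := h v
      rw [hd.commute.eq, mul_apply, (hd v).resolve_right hv] at this
      exact this hv
    obtain ⟨M, hM, hv, ha, hl⟩ := ih₁ h₁
    obtain ⟨M', hM', hv', ha', hl'⟩ := ih₂ h₂
    have hsup := hd.disjoint_support
    have hdis : Disjoint M.verts M'.verts := Set.disjoint_left.2 fun x hx hx' =>
      Finset.disjoint_left.1 hsup (hv hx) (hv' hx')
    refine ⟨_, isMatching_sup hM hM' hdis, ?_, ?_, ?_⟩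
    · rw [hd.support_mul, Subgraph.verts_sup, Set.union_subset_iff]
      exact ⟨fun x hx => Finset.mem_union_left _ (hv hx),
        fun x hx => Finset.mem_union_right _ (hv' hx)⟩
    · intro x y hxy
      rw [hfac]
      rcases Subgraph.sup_adj.1 hxy with hxy | hxy
      · obtain ⟨ρ, hρ, hx⟩ := ha x y hxy
        exact ⟨ρ, Finset.mem_union_left _ hρ, hx⟩
      · obtain ⟨ρ, hρ, hx⟩ := ha' x y hxy
        exact ⟨ρ, Finset.mem_union_right _ hρ, hx⟩
    · have hodd : (oddFactors (σ * τ)).card = (oddFactors σ).card + (oddFactors τ).card := by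
        rw [oddFactors, hfac, Finset.filter_union, Finset.card_union_of_disjoint]
        · rfl
        · exact Finset.disjoint_filter_filter hd.disjoint_cycleFactorsFinset
      rw [hd.card_support_mul, ncard_edgeSet_sup hdis, hodd]
      omega

/-- A cycle of length at least three of an edge-preserving permutation traces a cycle of `G`. -/
lemma cycleOn_support_of_isCycle {τ : Equiv.Perm V} (h : AdjPerm G τ) (hτ : τ.IsCycle)
    (h3 : 3 ≤ τ.support.card) : CycleOn G τ.support := by
  obtain ⟨x, hx, -⟩ := id hτ
  have hlen := length_toList_of_isCycle hτ hx
  have hne : τ.toList x ≠ [] := by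
    intro h0
    rw [h0] at hlen
    simp at hlen
    omega
  set p := Walk.ofSupport _ hne (isChain_toList h hx) with hp
  have hsup : p.support = τ.toList x := Walk.support_ofSupport _ _
  have hpath : p.IsPath := by
    rw [Walk.isPath_def, hsup]
    exact nodup_toList τ x
  have hlast : (τ.toList x).getLast hne = (τ ^ (τ.support.card - 1)) x := by
    rw [List.getLast_eq_getElem, getElem_toList, hlen]
  have hhead : (τ.toList x).head hne = x := by
    rw [List.head_eq_getElem, getElem_toList]
    simp
  have hclose : τ ((τ.toList x).getLast hne) = (τ.toList x).head hne := by
    rw [hlast, hhead, ← mul_apply, ← pow_succ', Nat.sub_add_cancel (by omega), ← hτ.orderOf,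
      pow_orderOf_eq_one, one_apply]
  have hlastmem : (τ.toList x).getLast hne ∈ τ.support :=
    (mem_toList_iff_of_isCycle hτ hx).1 (List.getLast_mem hne)
  have hadj : G.Adj ((τ.toList x).getLast hne) ((τ.toList x).head hne) := by
    have := h _ (mem_support.1 hlastmem)
    rwa [hclose] at this
  refine ⟨_, Walk.cons hadj p, (Walk.cons_isCycle_iff _ _).2 ⟨hpath, fun he => ?_⟩, fun y => ?_⟩
  · have h1 := hpath.length_eq_one_of_mem_edges (Sym2.eq_swap ▸ he)
    have h2 := p.length_support
    rw [hsup, hlen] at h2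
    omega
  · rw [Walk.support_cons, List.mem_cons, hsup, mem_toList_iff_of_isCycle hτ hx]
    constructor
    · rintro (rfl | h)
      exacts [hlastmem, h]
    · exact Or.inr

lemma CycleOn.three_le_card {S : Finset V} (h : CycleOn G S) : 3 ≤ S.card := by
  obtain ⟨u, w, hw, hS⟩ := h
  have hsub : w.support.tail.toFinset ⊆ S := fun x hx =>
    (hS x).1 (List.mem_of_mem_tail (List.mem_toFinset.1 hx))
  have := Finset.card_le_card hsub
  rw [List.toFinset_card_of_nodup hw.support_nodup, List.length_tail, Walk.length_support] at this
  have := hw.three_le_length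
  omega

/-- Every cycle of `G` can be rotated. -/
lemma CycleOn.exists_rotation {S : Finset V} (h : CycleOn G S) :
    ∃ ρ : Equiv.Perm V, ρ.support = S ∧ AdjPerm G ρ := by
  obtain ⟨u, w, hw, hS⟩ := h
  have hn := hw.support_nodup
  set l := w.support.tail with hl
  have hlen : l.length = w.length := by rw [hl, List.length_tail, Walk.length_support]; rfl
  have h3 := hw.three_le_length
  have hsup : w.support = u :: l := w.cons_tail_support.symm
  have hchain : (u :: l).IsChain G.Adj := hsup ▸ w.isChain_adj_support
  have hget : ∀ i (hi : i < l.length), l[i] = w.getVert (i + 1) := by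
    intro i hi
    have : l[i] = w.support[i + 1]'(by rw [Walk.length_support]; omega) := by
      simp [hl]
    rw [this, Walk.support_getElem_eq_getVert]
  have hu : u ∈ l := by
    have : l[l.length - 1]'(by omega) = u := by
      rw [hget, Nat.sub_add_cancel (by omega), hlen, Walk.getVert_length]
    rw [← this]
    exact List.getElem_mem _
  refine ⟨l.formPerm, ?_, ?_⟩
  · rw [List.support_formPerm_of_nodup l hn]
    · ext x
      rw [List.mem_toFinset, ← hS, hsup, List.mem_cons]
      constructor
      · exact Or.inr
      · rintro (rfl | h)
        exacts [hu, h]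
    · intro x hx
      rw [hx] at hlen
      simp at hlen
      omega
  · intro x hx
    have hxl : x ∈ l := by
      by_contra hcon
      exact hx (List.formPerm_apply_of_notMem hcon)
    obtain ⟨i, hi, rfl⟩ := List.getElem_of_mem hxl
    rw [List.formPerm_apply_getElem l hn]
    by_cases hlt : i + 1 < l.length
    · simp only [Nat.mod_eq_of_lt hlt]
      rw [hget, hget]
      exact w.adj_getVert_succ (by omega)
    · have hi' : i + 1 = l.length := by omega
      simp only [hi', Nat.mod_self]
      rw [hget, hget, hi', hlen, Walk.getVert_length]
      have := w.adj_getVert_succ (i := 0) (by omega)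
      simpa using this

/-- If all cycles of even length of `σ` are transpositions and there are `k` of them, then the
sign of `σ` is `(-1) ^ k`. -/
lemma sign_and_card_support {σ : Equiv.Perm V}
    (h : ∀ τ ∈ σ.cycleFactorsFinset, ¬ Odd τ.support.card → τ.support.card = 2) :
    ∃ k : ℕ, sign σ = (-1) ^ k ∧
      σ.support.card = 2 * k + ∑ τ ∈ oddFactors σ, τ.support.card := by
  refine ⟨({τ ∈ σ.cycleFactorsFinset | ¬ Odd τ.support.card}).card, ?_, ?_⟩
  · have hsign : sign σ = ∏ τ ∈ σ.cycleFactorsFinset, sign τ := by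
      conv_lhs => rw [← cycleFactorsFinset_noncommProd σ]
      rw [Finset.map_noncommProd, Finset.noncommProd_eq_prod]
      rfl
    rw [hsign, ← Finset.prod_filter_mul_prod_filter_not _ (fun τ => Odd τ.support.card),
      Finset.prod_eq_one, one_mul, Finset.prod_eq_pow_card]
    · intro τ hτ
      rw [Finset.mem_filter] at hτ
      rw [(mem_cycleFactorsFinset_iff.1 hτ.1).1.sign, h τ hτ.1 hτ.2]
      rfl
    · intro τ hτ
      rw [Finset.mem_filter] at hτ
      rw [(mem_cycleFactorsFinset_iff.1 hτ.1).1.sign, hτ.2.neg_one_pow, neg_neg]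
  · have hsum : σ.support.card = ∑ τ ∈ σ.cycleFactorsFinset, τ.support.card := by
      rw [← sum_cycleType, cycleType_def]
      rfl
    rw [hsum, ← Finset.sum_filter_add_sum_filter_not _ (fun τ => Odd τ.support.card), add_comm,
      oddFactors]
    congr 1
    rw [Finset.sum_const_nat (m := 2), mul_comm]
    intro τ hτ
    rw [Finset.mem_filter] at hτ
    exact h τ hτ.1 hτ.2

end Permutations

end GraphInertia

namespace GraphInertia

open SimpleGraph Matrix

variable {V : Type*} [Fintype V] [DecidableEq V] {G : SimpleGraph V}

/-! ### Inertia indices of a graph -/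

open Classical in
/-- The real adjacency matrix, formed with classical decidability so that it can be used for
graphs obtained by deleting vertices and edges. -/
noncomputable def realAdjMatrix (G : SimpleGraph V) : Matrix V V ℝ := G.adjMatrix ℝ

lemma realAdjMatrix_of_adj {i j : V} (h : G.Adj i j) : realAdjMatrix G i j = 1 := by
  simp [realAdjMatrix, h]

lemma realAdjMatrix_of_not_adj {i j : V} (h : ¬ G.Adj i j) : realAdjMatrix G i j = 0 := by
  simp [realAdjMatrix, h]

lemma realAdjMatrix_isHermitian (G : SimpleGraph V) : (realAdjMatrix G).IsHermitian := by
  refine Matrix.IsHermitian.ext fun i j => ?_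
  by_cases h : G.Adj i j
  · simp [realAdjMatrix_of_adj h, realAdjMatrix_of_adj h.symm]
  · simp [realAdjMatrix_of_not_adj h, realAdjMatrix_of_not_adj fun h' : G.Adj j i => h h'.symm]

lemma posInertia_eq_posIdx [DecidableRel G.Adj] : posInertia G = posIdx (realAdjMatrix G) := by
  have : realAdjMatrix G = G.adjMatrix ℝ := by
    ext i j
    by_cases h : G.Adj i j <;> simp [realAdjMatrix, h]
  rw [this, posIdx_eq_card (G.isHermitian_adjMatrix ℝ)]
  rfl

/-- If `H` is the subgraph of `G` induced on `S`, kept on the vertex set of `G`, its quadratic form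
is that of `G` after restriction to the coordinates in `S`. -/
lemma realAdjMatrix_induced_form {H : SimpleGraph V} {S : Finset V}
    (h : ∀ a b, H.Adj a b ↔ G.Adj a b ∧ a ∈ S ∧ b ∈ S) (x : V → ℝ) :
    x ⬝ᵥ realAdjMatrix H *ᵥ x =
      restrictCoords S x ⬝ᵥ realAdjMatrix G *ᵥ restrictCoords S x := by
  simp only [dotProduct, mulVec, Finset.mul_sum]
  refine Finset.sum_congr rfl fun i _ => Finset.sum_congr rfl fun j _ => ?_
  by_cases hi : i ∈ S <;> by_cases hj : j ∈ S <;> by_cases hG : G.Adj i j <;>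
    simp [realAdjMatrix, h, hi, hj, hG, restrictCoords_apply]

lemma posIdx_induced_le {H : SimpleGraph V} {S : Finset V}
    (h : ∀ a b, H.Adj a b ↔ G.Adj a b ∧ a ∈ S ∧ b ∈ S) :
    posIdx (-realAdjMatrix H) ≤ posIdx (-realAdjMatrix G) :=
  posIdx_le_of_forall_le (restrictCoords S) fun x => by
    simp [neg_mulVec, realAdjMatrix_induced_form h]

lemma posIdx_le_induced_add {H : SimpleGraph V} {S : Finset V}
    (h : ∀ a b, H.Adj a b ↔ G.Adj a b ∧ a ∈ S ∧ b ∈ S) :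
    posIdx (realAdjMatrix G) ≤ posIdx (realAdjMatrix H) + Sᶜ.card :=
  posIdx_le_add_card LinearMap.id _ fun x hx => by
    rw [LinearMap.id_apply, realAdjMatrix_induced_form h, restrictCoords_eq_self hx]

/-- The padding by the identity contributes no negative directions to a principal block. -/
lemma posIdx_neg_principalBlock_le_induced {H : SimpleGraph V} {S : Finset V}
    (h : ∀ a b, H.Adj a b ↔ G.Adj a b ∧ a ∈ S ∧ b ∈ S) :
    posIdx (-principalBlock (realAdjMatrix G) S) ≤ posIdx (-realAdjMatrix H) :=
  posIdx_le_of_forall_le LinearMap.id fun x => by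
    have : 0 ≤ ∑ i ∈ Sᶜ, x i ^ 2 := Finset.sum_nonneg fun i _ => sq_nonneg _
    rw [LinearMap.id_apply, neg_mulVec, neg_mulVec, dotProduct_neg, dotProduct_neg,
      principalBlock_form, realAdjMatrix_induced_form h]
    linarith

lemma deleteIncidenceSet_adj_iff (v a b : V) :
    (G.deleteIncidenceSet v).Adj a b ↔
      G.Adj a b ∧ a ∈ ({v}ᶜ : Finset V) ∧ b ∈ ({v}ᶜ : Finset V) := by
  rw [deleteIncidenceSet_adj]
  simp

lemma posIdx_le_deleteIncidenceSet_add_one (v : V) :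
    posIdx (realAdjMatrix G) ≤ posIdx (realAdjMatrix (G.deleteIncidenceSet v)) + 1 := by
  simpa using posIdx_le_induced_add (deleteIncidenceSet_adj_iff (G := G) v)

lemma posIdx_neg_eq_of_isAcyclic (hG : G.IsAcyclic) :
    posIdx (-realAdjMatrix G) = posIdx (realAdjMatrix G) := by
  obtain ⟨C⟩ := hG.colorable_two
  -- Changing the sign on one colour class turns the adjacency matrix into its negative.
  let s : V → ℝ := fun v => if C v = 0 then 1 else -1
  let L : (V → ℝ) →ₗ[ℝ] (V → ℝ) := LinearMap.pi fun v => s v • LinearMap.proj v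
  have hs : ∀ i j, G.Adj i j → s i * s j = -1 := by
    intro i j hij
    have hne := C.valid hij
    simp only [s]
    split_ifs with h₁ h₂ h₂
    · exact absurd (h₁.trans h₂.symm) hne
    · norm_num
    · norm_num
    · exact absurd ((Fin.eq_one_of_ne_zero _ h₁).trans (Fin.eq_one_of_ne_zero _ h₂).symm) hne
  have key : ∀ x : V → ℝ, L x ⬝ᵥ realAdjMatrix G *ᵥ L x = -(x ⬝ᵥ realAdjMatrix G *ᵥ x) := by
    intro x
    simp only [dotProduct, mulVec, Finset.mul_sum, ← Finset.sum_neg_distrib]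
    refine Finset.sum_congr rfl fun i _ => Finset.sum_congr rfl fun j _ => ?_
    by_cases hij : G.Adj i j
    · have := hs i j hij
      simp only [L, LinearMap.pi_apply, LinearMap.smul_apply, LinearMap.proj_apply, smul_eq_mul,
        realAdjMatrix_of_adj hij]
      linear_combination (x i * x j) * this
    · simp [realAdjMatrix_of_not_adj hij]
  refine le_antisymm (posIdx_le_of_forall_le L fun x => ?_) (posIdx_le_of_forall_le L fun x => ?_)
  · rw [key, neg_mulVec, dotProduct_neg]
  · rw [neg_mulVec, dotProduct_neg, key, neg_neg]

/-! ### Principal minors of the adjacency matrix -/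

lemma prod_principalBlock (S : Finset V) (σ : Equiv.Perm V) [Decidable (AdjPerm G σ)] :
    ∏ i, principalBlock (realAdjMatrix G) S (σ i) i =
      if AdjPerm G σ ∧ σ.support = S then 1 else 0 := by
  split_ifs with h
  · obtain ⟨hσ, rfl⟩ := h
    refine Finset.prod_eq_one fun i _ => ?_
    by_cases hi : σ i = i
    · have : i ∉ σ.support := by simpa using hi
      simp [principalBlock, hi]
    · have h₁ : i ∈ σ.support := by simpa using hi
      have h₂ : σ i ∈ σ.support := by simpa using hi
      simp only [principalBlock, of_apply, h₁, h₂, and_self, if_true]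
      exact realAdjMatrix_of_adj (hσ i hi).symm
  · by_contra hne
    rw [← ne_eq, Finset.prod_ne_zero_iff] at hne
    have hmem : ∀ i ∈ S, σ i ∈ S ∧ G.Adj i (σ i) := by
      intro i hi
      have := hne i (Finset.mem_univ i)
      by_cases hσi : σ i ∈ S
      · refine ⟨hσi, ?_⟩
        by_contra hadj
        apply this
        simp only [principalBlock, of_apply, hσi, hi, and_self, if_true]
        exact realAdjMatrix_of_not_adj fun h => hadj h.symm
      · have hne' : σ i ≠ i := fun h => hσi (by rw [h]; exact hi)
        simp [principalBlock, hσi, hne'] at this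
    have hfix : ∀ i ∉ S, σ i = i := by
      intro i hi
      by_contra hσi
      have := hne i (Finset.mem_univ i)
      simp [principalBlock, hi, hσi] at this
    refine h ⟨fun v hv => (hmem v ?_).2, ?_⟩
    · by_contra hvS
      exact hv (hfix v hvS)
    · ext i
      rw [Equiv.Perm.mem_support]
      constructor
      · intro hi
        by_contra hiS
        exact hi (hfix i hiS)
      · exact fun hi => (hmem i hi).2.ne'

lemma exists_adjPerm_of_det_ne_zero {S : Finset V}
    (h : (principalBlock (realAdjMatrix G) S).det ≠ 0) :
    ∃ σ : Equiv.Perm V, AdjPerm G σ ∧ σ.support = S := by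
  classical
  by_contra hcon
  refine h ?_
  rw [det_apply]
  refine Finset.sum_eq_zero fun σ _ => ?_
  rw [prod_principalBlock, if_neg fun hσ => hcon ⟨σ, hσ⟩, smul_zero]

/-- There is no cancellation in a principal minor all of whose terms have the same sign. -/
lemma det_principalBlock_mul_pos {S : Finset V} {m : ℕ}
    (hs : ∀ σ : Equiv.Perm V, AdjPerm G σ → σ.support = S → Equiv.Perm.sign σ = (-1) ^ m)
    (he : ∃ σ : Equiv.Perm V, AdjPerm G σ ∧ σ.support = S) :
    0 < (principalBlock (realAdjMatrix G) S).det * (-1) ^ m := by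
  classical
  have hterm : ∀ σ : Equiv.Perm V,
      (Equiv.Perm.sign σ • ∏ i, principalBlock (realAdjMatrix G) S (σ i) i) * (-1) ^ m =
        if AdjPerm G σ ∧ σ.support = S then 1 else 0 := by
    intro σ
    rw [prod_principalBlock]
    split_ifs with h
    · rw [hs σ h.1 h.2, Units.smul_def]
      push_cast
      rw [zsmul_one]
      push_cast
      rw [← mul_pow]
      norm_num
    · simp
  rw [det_apply, Finset.sum_mul]
  simp only [hterm]
  obtain ⟨σ, hσ⟩ := he
  refine Finset.sum_pos' (fun τ _ => by split_ifs <;> norm_num) ⟨σ, Finset.mem_univ _, ?_⟩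
  rw [if_pos hσ]
  norm_num

lemma AdjPerm.cycleOn_of_mem_oddFactors {σ τ : Equiv.Perm V} (h : AdjPerm G σ)
    (hτ : τ ∈ oddFactors σ) : CycleOn G τ.support := by
  rw [oddFactors, Finset.mem_filter] at hτ
  have hc := (Equiv.Perm.mem_cycleFactorsFinset_iff.1 hτ.1).1
  refine cycleOn_support_of_isCycle (h.of_mem_cycleFactorsFinset hτ.1) hc ?_
  have := hc.two_le_card_support
  obtain ⟨k, hk⟩ := hτ.2
  omega

lemma AdjPerm.cycleOn_of_card_ne_two {σ τ : Equiv.Perm V} (h : AdjPerm G σ)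
    (hτ : τ ∈ σ.cycleFactorsFinset) (h2 : τ.support.card ≠ 2) : CycleOn G τ.support := by
  have hc := (Equiv.Perm.mem_cycleFactorsFinset_iff.1 hτ).1
  refine cycleOn_support_of_isCycle (h.of_mem_cycleFactorsFinset hτ) hc ?_
  have := hc.two_le_card_support
  omega

lemma disjoint_support_of_mem_cycleFactorsFinset {σ τ τ' : Equiv.Perm V}
    (hτ : τ ∈ σ.cycleFactorsFinset) (hτ' : τ' ∈ σ.cycleFactorsFinset) (hne : τ ≠ τ') :
    Disjoint τ.support τ'.support :=
  (Equiv.Perm.cycleFactorsFinset_pairwise_disjoint σ hτ hτ' hne).disjoint_support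

lemma injOn_support_cycleFactorsFinset (σ : Equiv.Perm V) :
    Set.InjOn Equiv.Perm.support (σ.cycleFactorsFinset : Set (Equiv.Perm V)) := by
  intro τ hτ τ' hτ' h
  by_contra hne
  have hd := disjoint_support_of_mem_cycleFactorsFinset hτ hτ' hne
  rw [h, disjoint_self] at hd
  have := (Equiv.Perm.mem_cycleFactorsFinset_iff.1 hτ').1.two_le_card_support
  rw [hd] at this
  simp at this

/-- The vertex sets of the odd cycles of a permutation. -/
def oddSupports (σ : Equiv.Perm V) : Finset (Finset V) :=
  (oddFactors σ).image Equiv.Perm.support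

lemma oddFactors_subset (σ : Equiv.Perm V) : oddFactors σ ⊆ σ.cycleFactorsFinset :=
  Finset.filter_subset _ _

lemma card_oddSupports (σ : Equiv.Perm V) : (oddSupports σ).card = (oddFactors σ).card :=
  Finset.card_image_of_injOn
    ((injOn_support_cycleFactorsFinset σ).mono (oddFactors_subset σ))

lemma AdjPerm.cycleOn_of_mem_oddSupports {σ : Equiv.Perm V} (h : AdjPerm G σ) {S : Finset V}
    (hS : S ∈ oddSupports σ) : CycleOn G S := by
  obtain ⟨τ, hτ, rfl⟩ := Finset.mem_image.1 hS
  exact h.cycleOn_of_mem_oddFactors hτ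

lemma AdjPerm.card_oddFactors_le {σ : Equiv.Perm V} (h : AdjPerm G σ) :
    ((oddFactors σ).card : ℤ) ≤ cyclomaticNumber G := by
  rw [← card_oddSupports]
  refine card_le_cyclomaticNumber _ (fun S hS => h.cycleOn_of_mem_oddSupports hS) ?_
  intro S hS S' hS' hne
  obtain ⟨τ, hτ, rfl⟩ := Finset.mem_image.1 hS
  obtain ⟨τ', hτ', rfl⟩ := Finset.mem_image.1 hS'
  exact disjoint_support_of_mem_cycleFactorsFinset (oddFactors_subset σ hτ)
    (oddFactors_subset σ hτ') (by rintro rfl; exact hne rfl)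

lemma exists_principal_set (G : SimpleGraph V) :
    ∃ S : Finset V, S.card = posIdx (realAdjMatrix G) + posIdx (-realAdjMatrix G) ∧
      (principalBlock (realAdjMatrix G) S).det ≠ 0 := by
  rw [posIdx_add_posIdx_neg (realAdjMatrix_isHermitian G)]
  exact exists_principalBlock_det_ne_zero (realAdjMatrix_isHermitian G)

/-! ### The upper bound and the graphs attaining it -/

lemma posIdx_le_matchingNumber_of_isAcyclic (hG : G.IsAcyclic) :
    posIdx (realAdjMatrix G) ≤ matchingNumber G := by
  obtain ⟨S, hS, hdet⟩ := exists_principal_set G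
  obtain ⟨σ, hσ, rfl⟩ := exists_adjPerm_of_det_ne_zero hdet
  obtain ⟨M, hM, -, -, hcard⟩ := hσ.exists_matching
  have hle := ncard_le_matchingNumber hM
  have hodd := hσ.card_oddFactors_le
  rw [cyclomaticNumber_of_isAcyclic hG] at hodd
  rw [posIdx_neg_eq_of_isAcyclic hG] at hS
  omega

lemma exists_mem_cycle_of_not_isAcyclic (hG : ¬ G.IsAcyclic) :
    ∃ (u d : V) (w : G.Walk u u), w.IsCycle ∧ s(u, d) ∈ w.edges := by
  simp only [IsAcyclic, not_forall, not_not] at hG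
  obtain ⟨u, w, hw⟩ := hG
  obtain ⟨d, he⟩ := exists_mem_edges_of_mem_support hw w.start_mem_support
  exact ⟨u, d, w, hw, he⟩

lemma ncard_edgeSet_deleteIncidenceSet_lt {v d : V} (h : G.Adj v d) :
    (G.deleteIncidenceSet v).edgeSet.ncard < G.edgeSet.ncard := by
  have h₁ := ncard_edgeSet_deleteEdges h
  have h₂ := Set.ncard_le_ncard (edgeSet_mono (deleteIncidenceSet_le_deleteEdges (G := G) v d))
    (Set.toFinite _)
  omega

/-- The bound `p(G) ≤ m(G) + c(G)`: deleting a vertex of a cycle costs at most one positive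
eigenvalue and lowers `c` by at least one, and a forest has `p ≤ m`. -/
theorem posIdx_le_matchingNumber_add_cyclomaticNumber (G : SimpleGraph V) :
    (posIdx (realAdjMatrix G) : ℤ) ≤ matchingNumber G + cyclomaticNumber G := by
  induction hn : G.edgeSet.ncard using Nat.strong_induction_on generalizing G with
  | _ n ih =>
    by_cases hG : G.IsAcyclic
    · have := posIdx_le_matchingNumber_of_isAcyclic hG
      have := cyclomaticNumber_nonneg (G := G)
      omega
    · obtain ⟨u, d, w, hw, he⟩ := exists_mem_cycle_of_not_isAcyclic hG
      have h₁ := ih _ (hn ▸ ncard_edgeSet_deleteIncidenceSet_lt (w.adj_of_mem_edges he)) _ rfl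
      have h₂ := posIdx_le_deleteIncidenceSet_add_one (G := G) u
      have h₃ := cyclomaticNumber_deleteIncidenceSet_le hw he
      have h₄ := matchingNumber_mono (G.deleteIncidenceSet_le u)
      omega

/-- `G` attains the upper bound: `p(G) = m(G) + c(G)`. -/
def Extremal (G : SimpleGraph V) : Prop :=
  (posIdx (realAdjMatrix G) : ℤ) = matchingNumber G + cyclomaticNumber G

/-- All inequalities in the proof of the upper bound are equalities when a vertex of a cycle is
deleted from an extremal graph. -/
lemma Extremal.deleteIncidenceSet (hG : Extremal G) {u v : V} {w : G.Walk u u} (hw : w.IsCycle)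
    (hv : v ∈ w.support) :
    Extremal (G.deleteIncidenceSet v) ∧
      matchingNumber (G.deleteIncidenceSet v) = matchingNumber G ∧
      cyclomaticNumber (G.deleteIncidenceSet v) = cyclomaticNumber G - 1 := by
  obtain ⟨d, he⟩ := exists_mem_edges_of_mem_support hw hv
  have h₁ := posIdx_le_matchingNumber_add_cyclomaticNumber (G.deleteIncidenceSet v)
  have h₂ := posIdx_le_deleteIncidenceSet_add_one (G := G) v
  have h₃ := cyclomaticNumber_deleteIncidenceSet_le hw he
  have h₄ := matchingNumber_mono (G.deleteIncidenceSet_le v)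
  unfold Extremal at hG ⊢
  omega

lemma Extremal.matchingNumber_le (hG : Extremal G) :
    matchingNumber G ≤ posIdx (-realAdjMatrix G) := by
  induction hn : G.edgeSet.ncard using Nat.strong_induction_on generalizing G with
  | _ n ih =>
    by_cases hac : G.IsAcyclic
    · rw [posIdx_neg_eq_of_isAcyclic hac]
      have := cyclomaticNumber_nonneg (G := G)
      unfold Extremal at hG
      omega
    · obtain ⟨u, d, w, hw, he⟩ := exists_mem_cycle_of_not_isAcyclic hac
      obtain ⟨h₁, h₂, -⟩ := hG.deleteIncidenceSet hw w.start_mem_support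
      have h₃ := ih _ (hn ▸ ncard_edgeSet_deleteIncidenceSet_lt (w.adj_of_mem_edges he)) h₁ rfl
      have h₄ := posIdx_induced_le (deleteIncidenceSet_adj_iff (G := G) u)
      omega

/-! ### Extremal graphs satisfy the three conditions -/

lemma CycleOn.exists_isCycleOf {S : Finset V} (h : CycleOn G S) :
    ∃ C : G.Subgraph, IsCycleOf G C ∧ C.verts = S := by
  obtain ⟨u, w, hw, hS⟩ := h
  refine ⟨w.toSubgraph, ⟨u, w, hw, rfl⟩, Set.ext fun x => ?_⟩
  rw [Walk.mem_verts_toSubgraph, hS]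
  rfl

lemma cycleOn_of_isCycleOf {C : G.Subgraph} (h : IsCycleOf G C) :
    ∃ S : Finset V, CycleOn G S ∧ C.verts = S := by
  obtain ⟨u, w, hw, rfl⟩ := h
  refine ⟨w.support.toFinset, ⟨u, w, hw, fun x => by simp⟩, Set.ext fun x => ?_⟩
  rw [Walk.mem_verts_toSubgraph]
  simp

/-- In an extremal graph two cycles through `v` use the same edges at `v`, since otherwise
deleting `v` would lower the cyclomatic number by two. -/
lemma Extremal.mem_edges (hG : Extremal G) {u₁ u₂ v d : V} {w₁ : G.Walk u₁ u₁}
    {w₂ : G.Walk u₂ u₂} (h₁ : w₁.IsCycle) (h₂ : w₂.IsCycle) (hv : v ∈ w₁.support)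
    (he : s(v, d) ∈ w₂.edges) : s(v, d) ∈ w₁.edges := by
  by_contra hcon
  have := cyclomaticNumber_deleteIncidenceSet_le_sub_two h₁ h₂ hv hcon he
  have := (hG.deleteIncidenceSet h₁ hv).2.2
  omega

lemma Extremal.support_subset (hG : Extremal G) {u₁ u₂ v : V} {w₁ : G.Walk u₁ u₁}
    {w₂ : G.Walk u₂ u₂} (h₁ : w₁.IsCycle) (h₂ : w₂.IsCycle) (hv₁ : v ∈ w₁.support)
    (hv₂ : v ∈ w₂.support) : ∀ x ∈ w₁.support, x ∈ w₂.support := by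
  have key : ∀ (a b : V) (p : G.Walk a b), a ∈ w₂.support → p.edges ⊆ w₁.edges →
      ∀ x ∈ p.support, x ∈ w₂.support := by
    intro a b p
    induction p with
    | nil =>
      intro ha _ x hx
      rw [Walk.support_nil, List.mem_singleton] at hx
      exact hx ▸ ha
    | cons h p ih =>
      intro ha hp x hx
      rw [Walk.edges_cons, List.cons_subset] at hp
      rw [Walk.support_cons, List.mem_cons] at hx
      rcases hx with rfl | hx
      · exact ha
      · exact ih (w₂.snd_mem_support_of_mem_edges (hG.mem_edges h₂ h₁ ha hp.1)) hp.2 x hx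
  intro x hx
  refine key v v (w₁.rotate v hv₁) hv₂ (fun e he => (w₁.rotate_edges v hv₁).mem_iff.1 he) x ?_
  rwa [Walk.mem_support_rotate_iff]

lemma Extremal.toSubgraph_le (hG : Extremal G) {u₁ u₂ v : V} {w₁ : G.Walk u₁ u₁}
    {w₂ : G.Walk u₂ u₂} (h₁ : w₁.IsCycle) (h₂ : w₂.IsCycle) (hv₁ : v ∈ w₁.support)
    (hv₂ : v ∈ w₂.support) : w₁.toSubgraph ≤ w₂.toSubgraph := by
  have hsub := hG.support_subset h₁ h₂ hv₁ hv₂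
  constructor
  · intro x hx
    rw [Walk.mem_verts_toSubgraph] at hx ⊢
    exact hsub x hx
  · intro x y hxy
    rw [Walk.adj_toSubgraph_iff_mem_edges] at hxy ⊢
    exact hG.mem_edges h₂ h₁ (hsub x (w₁.fst_mem_support_of_mem_edges hxy)) hxy

theorem Extremal.disjoint_cycles (hG : Extremal G) {C₁ C₂ : G.Subgraph} (h₁ : IsCycleOf G C₁)
    (h₂ : IsCycleOf G C₂) (hne : C₁ ≠ C₂) : Disjoint C₁.verts C₂.verts := by
  obtain ⟨u₁, w₁, hw₁, rfl⟩ := h₁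
  obtain ⟨u₂, w₂, hw₂, rfl⟩ := h₂
  rw [Set.disjoint_left]
  intro v hv₁ hv₂
  rw [Walk.mem_verts_toSubgraph] at hv₁ hv₂
  exact hne (le_antisymm (hG.toSubgraph_le hw₁ hw₂ hv₁ hv₂) (hG.toSubgraph_le hw₂ hw₁ hv₂ hv₁))

lemma disjoint_of_cycleOn
    (hd : ∀ C₁ C₂ : G.Subgraph, IsCycleOf G C₁ → IsCycleOf G C₂ → C₁ ≠ C₂ →
      Disjoint C₁.verts C₂.verts)
    {S T : Finset V} (hS : CycleOn G S) (hT : CycleOn G T) (hne : S ≠ T) : Disjoint S T := by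
  obtain ⟨C₁, h₁, e₁⟩ := hS.exists_isCycleOf
  obtain ⟨C₂, h₂, e₂⟩ := hT.exists_isCycleOf
  have := hd C₁ C₂ h₁ h₂ fun h => hne (by rw [h, e₂] at e₁; exact_mod_cast e₁.symm)
  rw [e₁, e₂] at this
  exact_mod_cast this

lemma Extremal.disjoint_cycleOn (hG : Extremal G) {S T : Finset V} (hS : CycleOn G S)
    (hT : CycleOn G T) (hne : S ≠ T) : Disjoint S T :=
  disjoint_of_cycleOn (fun _ _ => hG.disjoint_cycles) hS hT hne

/-- For an extremal graph, a permutation contributing to a nonzero principal minor of maximal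
size has to use all cycles of the graph, and to cover so many vertices that the matching
extracted from it is a maximum matching. -/
lemma Extremal.adjPerm (hG : Extremal G) {σ : Equiv.Perm V} (hσ : AdjPerm G σ)
    (hcard : σ.support.card = posIdx (realAdjMatrix G) + posIdx (-realAdjMatrix G)) :
    ((oddFactors σ).card : ℤ) = cyclomaticNumber G ∧
      (∀ C, CycleOn G C → C ∈ oddSupports σ) ∧
      (σ.support.card : ℤ) = 2 * matchingNumber G + cyclomaticNumber G ∧
      ∃ M : G.Subgraph, M.IsMatching ∧ M.edgeSet.ncard = matchingNumber G ∧
        ∀ x y, M.Adj x y → ∃ τ ∈ σ.cycleFactorsFinset, x ∈ τ.support ∧ y ∈ τ.support := by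
  obtain ⟨M, hM, -, hMσ, hle⟩ := hσ.exists_matching
  have h₁ := hσ.card_oddFactors_le
  have h₂ := ncard_le_matchingNumber hM
  have h₃ := hG.matchingNumber_le
  have h₄ : (posIdx (realAdjMatrix G) : ℤ) = matchingNumber G + cyclomaticNumber G := hG
  refine ⟨by omega, fun C hC => ?_, by omega, M, hM, by omega, hMσ⟩
  by_contra hcon
  have hcyc : ∀ S ∈ insert C (oddSupports σ), CycleOn G S := by
    intro S hS
    rcases Finset.mem_insert.1 hS with rfl | hS
    exacts [hC, hσ.cycleOn_of_mem_oddSupports hS]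
  have := card_le_cyclomaticNumber (insert C (oddSupports σ)) hcyc fun S hS S' hS' hne =>
    hG.disjoint_cycleOn (hcyc S hS) (hcyc S' hS') hne
  rw [Finset.card_insert_of_notMem hcon, card_oddSupports] at this
  push_cast at this
  omega

theorem Extremal.exists_matching (hG : Extremal G) :
    ∃ M : G.Subgraph, IsMaximumMatching M ∧ Disjoint M.edgeSet (cycleLeavingEdges G) := by
  obtain ⟨S, hS, hdet⟩ := exists_principal_set G
  obtain ⟨σ, hσ, rfl⟩ := exists_adjPerm_of_det_ne_zero hdet
  obtain ⟨-, hall, -, M, hM, hcard, hfac⟩ := hG.adjPerm hσ hS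
  refine ⟨M, isMaximumMatching_iff.2 ⟨hM, hcard⟩, Set.disjoint_left.2 ?_⟩
  rintro e he ⟨-, C, hC, x, hx, y, hy, rfl⟩
  obtain ⟨T, hT, hCT⟩ := cycleOn_of_isCycleOf hC
  obtain ⟨τ', hτ', rfl⟩ := Finset.mem_image.1 (hall T hT)
  obtain ⟨τ, hτ, hxτ, hyτ⟩ := hfac x y (Subgraph.mem_edgeSet.1 he)
  rw [hCT, Finset.mem_coe] at hx hy
  have : τ = τ' := by
    by_contra hne
    exact Finset.disjoint_left.1 (disjoint_support_of_mem_cycleFactorsFinset hτ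
      (oddFactors_subset σ hτ') hne) hxτ hx
  exact hy (this ▸ hyτ)

lemma CycleOn.deleteIncidenceSet {S : Finset V} (h : CycleOn G S) {u : V} (hu : u ∉ S) :
    CycleOn (G.deleteIncidenceSet u) S := by
  obtain ⟨v, w, hw, hS⟩ := h
  have he : ∀ e ∈ w.edges, e ∈ (G.deleteIncidenceSet u).edgeSet := by
    intro e he
    induction e with | _ a b
    rw [mem_edgeSet, deleteIncidenceSet_adj]
    refine ⟨w.adj_of_mem_edges he, ?_, ?_⟩
    · rintro rfl
      exact hu ((hS _).1 (w.fst_mem_support_of_mem_edges he))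
    · rintro rfl
      exact hu ((hS _).1 (w.snd_mem_support_of_mem_edges he))
  exact ⟨v, w.transfer _ he, hw.transfer he, fun x => by rw [Walk.support_transfer, hS]⟩

lemma posIdx_add_posIdx_neg_principalBlock {S : Finset V}
    (h : (principalBlock (realAdjMatrix G) S).det ≠ 0) :
    posIdx (principalBlock (realAdjMatrix G) S) + posIdx (-principalBlock (realAdjMatrix G) S) =
      Fintype.card V := by
  rw [posIdx_add_posIdx_neg (principalBlock_isHermitian (realAdjMatrix_isHermitian G) S)]
  exact rank_of_isUnit _ ((isUnit_iff_isUnit_det _).2 (isUnit_iff_ne_zero.2 h))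

/-- Extremality determines the sign `(-1) ^ m(G)` of a principal minor of maximal size, while the
permutations contributing to it show that its sign is `(-1) ^ k`, where `2 k` is the number of
vertices covered outside the unique cycle. -/
lemma Extremal.card_mod_four_of_unique (hG : Extremal G) {C : Finset V} (hC : CycleOn G C)
    (huniq : ∀ C', CycleOn G C' → C' = C) : C.card % 4 = 1 := by
  obtain ⟨S, hS, hdet⟩ := exists_principal_set G
  have hsum : ∀ σ : Equiv.Perm V, AdjPerm G σ → σ.support = S → oddSupports σ = {C} := by
    intro σ hσ hσS
    obtain ⟨-, hall, -⟩ := hG.adjPerm hσ (by rw [hσS, hS])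
    refine Finset.eq_singleton_iff_unique_mem.2 ⟨hall C hC, fun C' hC' => ?_⟩
    exact huniq _ (hσ.cycleOn_of_mem_oddSupports hC')
  have hsign : ∀ σ : Equiv.Perm V, AdjPerm G σ → σ.support = S →
      Odd C.card ∧ ∃ k, Equiv.Perm.sign σ = (-1) ^ k ∧ S.card = 2 * k + C.card := by
    intro σ hσ hσS
    have hsupp := hsum σ hσ hσS
    have hodd : Odd C.card := by
      have : C ∈ oddSupports σ := by rw [hsupp]; exact Finset.mem_singleton_self _
      obtain ⟨τ, hτ, rfl⟩ := Finset.mem_image.1 this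
      exact (Finset.mem_filter.1 hτ).2
    obtain ⟨k, hk, hk'⟩ := sign_and_card_support (σ := σ) fun τ hτ hne => by
      by_contra h2
      exact hne (huniq _ (hσ.cycleOn_of_card_ne_two hτ h2) ▸ hodd)
    refine ⟨hodd, k, hk, ?_⟩
    have : ∑ τ ∈ oddFactors σ, τ.support.card = ∑ T ∈ oddSupports σ, T.card :=
      (Finset.sum_image ((injOn_support_cycleFactorsFinset σ).mono (oddFactors_subset σ))).symm
    rw [← hσS, hk', this, hsupp, Finset.sum_singleton]
  obtain ⟨σ, hσ, hσS⟩ := exists_adjPerm_of_det_ne_zero hdet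
  obtain ⟨hodd, k, -, hk⟩ := hsign σ hσ hσS
  obtain ⟨hc, -, hcard, -⟩ := hG.adjPerm hσ (by rw [hσS, hS])
  rw [← card_oddSupports, hsum σ hσ hσS, Finset.card_singleton] at hc
  rw [hσS] at hcard
  have hpos := det_principalBlock_mul_pos (G := G) (S := S) (m := k) (fun σ' hσ' hσS' => by
    obtain ⟨-, k', hs, hk'⟩ := hsign σ' hσ' hσS'
    rw [hs, show k' = k by omega]) ⟨σ, hσ, hσS⟩
  have hpos' := det_mul_neg_one_pow_pos
    (principalBlock_isHermitian (realAdjMatrix_isHermitian G) S) hdet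
  have hparity := even_iff_even_of_mul_neg_one_pow_pos hpos hpos'
  have hneg : posIdx (-principalBlock (realAdjMatrix G) S) = matchingNumber G := by
    have h₁ := posIdx_add_posIdx_neg_principalBlock hdet
    have h₂ := posIdx_principalBlock_le (realAdjMatrix G) S
    have h₃ := posIdx_neg_principalBlock_le (realAdjMatrix G) S
    have h₄ := S.card_add_card_compl
    have h₅ : (posIdx (realAdjMatrix G) : ℤ) = matchingNumber G + cyclomaticNumber G := hG
    omega
  rw [hneg, Nat.even_iff, Nat.even_iff] at hparity
  rw [Nat.odd_iff] at hodd
  push_cast at hc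
  omega

theorem Extremal.card_mod_four (hG : Extremal G) {C : Finset V} (hC : CycleOn G C) :
    C.card % 4 = 1 := by
  induction hn : G.edgeSet.ncard using Nat.strong_induction_on generalizing G with
  | _ n ih =>
    by_cases huniq : ∀ C', CycleOn G C' → C' = C
    · exact hG.card_mod_four_of_unique hC huniq
    · push Not at huniq
      obtain ⟨C', hC', hne⟩ := huniq
      obtain ⟨u, w, hw, hwC⟩ := id hC'
      have hu : u ∉ C := Finset.disjoint_left.1 (hG.disjoint_cycleOn hC' hC hne)
        ((hwC u).1 w.start_mem_support)
      obtain ⟨d, he⟩ := exists_mem_edges_of_mem_support hw w.start_mem_support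
      exact ih _ (hn ▸ ncard_edgeSet_deleteIncidenceSet_lt (w.adj_of_mem_edges he))
        (hG.deleteIncidenceSet hw w.start_mem_support).1 (hC.deleteIncidenceSet hu) rfl

/-! ### The three conditions imply extremality -/

/-- The vertices covered by `M` or lying on one of the cycles in `T`. -/
noncomputable def coveredSet (M : G.Subgraph) (T : Finset (Finset V)) : Finset V :=
  (Set.toFinite M.verts).toFinset ∪ T.biUnion id

lemma mem_coveredSet {M : G.Subgraph} {T : Finset (Finset V)} {v : V} :
    v ∈ coveredSet M T ↔ v ∈ M.verts ∨ ∃ C ∈ T, v ∈ C := by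
  simp [coveredSet]

/-- The conditions of the theorem, in terms of vertex sets of cycles: cycles are pairwise disjoint,
their lengths are `1` modulo `4`, and `M` is a maximum matching no edge of which leaves a cycle. -/
structure IsGoodMatching (M : G.Subgraph) : Prop where
  disjoint : ∀ {S T : Finset V}, CycleOn G S → CycleOn G T → S ≠ T → Disjoint S T
  card_mod_four : ∀ {C : Finset V}, CycleOn G C → C.card % 4 = 1
  isMatching : M.IsMatching
  ncard_edgeSet : M.edgeSet.ncard = matchingNumber G
  mem_of_adj : ∀ {C : Finset V}, CycleOn G C → ∀ {x y}, x ∈ C → M.Adj x y → y ∈ C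

namespace IsGoodMatching

variable {M : G.Subgraph}

/-- Cycles have odd length and are matched within themselves, so each has an unmatched vertex. -/
lemma exists_notMem_verts (h : IsGoodMatching M) {C : Finset V} (hC : CycleOn G C) :
    ∃ z ∈ C, z ∉ M.verts := by
  by_contra! hcon
  obtain ⟨μ, hμ, hadj, -⟩ := exists_involution_of_isMatching h.isMatching
  have h0 : ∑ _v ∈ C, (1 : ZMod 2) = 0 :=
    Finset.sum_involution (fun v _ => μ v) (fun _ _ => by decide)
      (fun v hv _ => (hadj v (hcon v hv)).ne.symm)
      (fun v hv => h.mem_of_adj hC hv (hadj v (hcon v hv))) (fun v _ => hμ v)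
  rw [Finset.sum_const, nsmul_one, ZMod.natCast_eq_zero_iff] at h0
  have := h.card_mod_four hC
  omega

/-- Rotating the cycles in `T` and exchanging matched vertices elsewhere gives a permutation
supported on `coveredSet M T`. All its odd cycles belong to `T`. -/
lemma exists_adjPerm (h : IsGoodMatching M) {T : Finset (Finset V)}
    (hT : ∀ C ∈ T, CycleOn G C) :
    ∃ σ : Equiv.Perm V, AdjPerm G σ ∧ σ.support = coveredSet M T ∧ oddSupports σ ⊆ T := by
  classical
  obtain ⟨μ, hμ, hadj, hfix⟩ := exists_involution_of_isMatching h.isMatching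
  choose! ρ hρS hρ using fun (C : Finset V) (hC : CycleOn G C) => hC.exists_rotation
  let f : V → V := fun v => if hv : ∃ C ∈ T, v ∈ C then ρ hv.choose v else μ v
  have f₁ : ∀ C ∈ T, ∀ v ∈ C, f v = ρ C v := by
    intro C hC v hv
    have hex : ∃ C ∈ T, v ∈ C := ⟨C, hC, hv⟩
    have : hex.choose = C := by
      by_contra hne
      exact Finset.disjoint_left.1 (h.disjoint (hT _ hex.choose_spec.1) (hT C hC) hne)
        hex.choose_spec.2 hv
    simp only [f, dif_pos hex, this]
  have f₂ : ∀ v, (∀ C ∈ T, v ∉ C) → f v = μ v := by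
    intro v hv
    have hex : ¬ ∃ C ∈ T, v ∈ C := fun ⟨C, hC, hvC⟩ => hv C hC hvC
    simp only [f, dif_neg hex]
  have hμadj : ∀ v, μ v ≠ v → M.Adj v (μ v) := by
    intro v hv
    refine hadj v ?_
    by_contra hcon
    exact hv (hfix v hcon)
  have hρmem : ∀ C ∈ T, ∀ v ∈ C, ρ C v ∈ C := by
    intro C hC v hv
    have hS := hρS C (hT C hC)
    have := Equiv.Perm.apply_mem_support.2 (show v ∈ (ρ C).support by rwa [hS])
    rwa [hS] at this
  have hμmem : ∀ v, (∀ C ∈ T, v ∉ C) → ∀ C ∈ T, μ v ∉ C := by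
    intro v hv C hC hcon
    have hne : μ v ≠ v := by
      intro he
      rw [he] at hcon
      exact hv C hC hcon
    exact hv C hC (h.mem_of_adj (hT C hC) hcon (hμadj v hne).symm)
  have hinj : Function.Injective f := by
    intro a b hab
    by_cases ha : ∃ C ∈ T, a ∈ C <;> by_cases hb : ∃ C ∈ T, b ∈ C
    · obtain ⟨C, hC, ha⟩ := ha
      obtain ⟨D, hD, hb⟩ := hb
      rw [f₁ C hC a ha, f₁ D hD b hb] at hab
      have : C = D := by
        by_contra hne
        exact Finset.disjoint_left.1 (h.disjoint (hT C hC) (hT D hD) hne) (hρmem C hC a ha)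
          (hab ▸ hρmem D hD b hb)
      subst this
      exact (ρ C).injective hab
    · obtain ⟨C, hC, ha⟩ := ha
      push Not at hb
      rw [f₁ C hC a ha, f₂ b hb] at hab
      exact absurd (hab ▸ hρmem C hC a ha) (hμmem b hb C hC)
    · obtain ⟨C, hC, hb⟩ := hb
      push Not at ha
      rw [f₁ C hC b hb, f₂ a ha] at hab
      exact absurd (hab.symm ▸ hρmem C hC b hb) (hμmem a ha C hC)
    · push Not at ha hb
      rw [f₂ a ha, f₂ b hb] at hab
      exact μ.injective hab
  let σ : Equiv.Perm V := Equiv.ofBijective f (Finite.injective_iff_bijective.1 hinj)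
  have hσf : ∀ v, σ v = f v := fun v => rfl
  have hσ : AdjPerm G σ := by
    intro v hv
    rw [hσf] at hv ⊢
    by_cases hex : ∃ C ∈ T, v ∈ C
    · obtain ⟨C, hC, hvC⟩ := hex
      rw [f₁ C hC v hvC] at hv ⊢
      exact hρ C (hT C hC) v hv
    · push Not at hex
      rw [f₂ v hex] at hv ⊢
      exact (hμadj v hv).adj_sub
  refine ⟨σ, hσ, ?_, ?_⟩
  · ext v
    rw [Equiv.Perm.mem_support, mem_coveredSet, hσf]
    by_cases hex : ∃ C ∈ T, v ∈ C
    · obtain ⟨C, hC, hvC⟩ := id hex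
      have : ρ C v ≠ v := by
        rw [← Equiv.Perm.mem_support, hρS C (hT C hC)]
        exact hvC
      simp only [f₁ C hC v hvC, this, hex, or_true, ne_eq, not_false_eq_true]
    · have hex' := hex
      push Not at hex'
      rw [f₂ v hex', or_iff_left hex]
      constructor
      · exact fun hv => (hμadj v hv).fst_mem
      · exact fun hv => (hadj v hv).ne.symm
  · intro S hS
    obtain ⟨τ, hτ, rfl⟩ := Finset.mem_image.1 hS
    have hcyc := hσ.cycleOn_of_mem_oddFactors hτ
    by_contra hcon
    have hτσ := Equiv.Perm.mem_cycleFactorsFinset_iff.1 (oddFactors_subset σ hτ)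
    -- Off the cycles in `T` the permutation is an involution, so it has no odd cycle there.
    have hval : ∀ v ∈ τ.support, τ v = μ v := by
      intro v hv
      rw [hτσ.2 v hv, hσf]
      refine f₂ v fun C hC hvC => ?_
      exact Finset.disjoint_left.1 (h.disjoint hcyc (hT C hC) fun he => hcon (he ▸ hC)) hv hvC
    have hsq : τ ^ 2 = 1 := by
      ext v
      rw [sq, Equiv.Perm.mul_apply, Equiv.Perm.one_apply]
      by_cases hv : v ∈ τ.support
      · rw [hval _ (Equiv.Perm.apply_mem_support.2 hv), hval v hv, hμ]
      · rw [Equiv.Perm.notMem_support.1 hv, Equiv.Perm.notMem_support.1 hv]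
    have hdvd := orderOf_dvd_of_pow_eq_one hsq
    rw [hτσ.1.orderOf] at hdvd
    have h1 := Nat.le_of_dvd two_pos hdvd
    have h2 := hcyc.three_le_card
    omega

/-- The matching extracted from the permutation of `exists_adjPerm` is no larger than `M`, so each
cycle has exactly one unmatched vertex. -/
lemma card_coveredSet (h : IsGoodMatching M) {T : Finset (Finset V)}
    (hT : ∀ C ∈ T, CycleOn G C) : (coveredSet M T).card = 2 * matchingNumber G + T.card := by
  classical
  refine le_antisymm ?_ ?_
  · obtain ⟨σ, hσ, hsupp, hsub⟩ := h.exists_adjPerm hT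
    obtain ⟨M', hM', -, -, hle⟩ := hσ.exists_matching
    have h₁ := ncard_le_matchingNumber hM'
    have h₂ := Finset.card_le_card hsub
    rw [card_oddSupports] at h₂
    rw [hsupp] at hle
    omega
  · choose z hzC hzM using fun (C : Finset V) (hC : CycleOn G C) => h.exists_notMem_verts hC
    let y : T → V := fun C => z C.1 (hT C.1 C.2)
    have hinj : Function.Injective y := by
      intro C D he
      by_contra hne
      have hy : y C ∈ D.1 := he ▸ hzC D.1 (hT D.1 D.2)
      exact Finset.disjoint_left.1
        (h.disjoint (hT C.1 C.2) (hT D.1 D.2) fun hCD => hne (Subtype.ext hCD))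
        (hzC C.1 (hT C.1 C.2)) hy
    have hsub : (Set.toFinite M.verts).toFinset ∪ Finset.univ.image y ⊆ coveredSet M T := by
      refine Finset.union_subset_union_right fun v hv => ?_
      obtain ⟨C, -, rfl⟩ := Finset.mem_image.1 hv
      exact Finset.mem_biUnion.2 ⟨C.1, C.2, hzC C.1 (hT C.1 C.2)⟩
    have hdis : Disjoint (Set.toFinite M.verts).toFinset (Finset.univ.image y) := by
      rw [Finset.disjoint_left]
      intro v hv hv'
      obtain ⟨C, -, rfl⟩ := Finset.mem_image.1 hv'
      exact hzM C.1 (hT C.1 C.2) ((Set.Finite.mem_toFinset _).1 hv)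
    have := Finset.card_le_card hsub
    rwa [Finset.card_union_of_disjoint hdis, Finset.card_image_of_injective _ hinj,
      Finset.card_univ, Fintype.card_coe,
      ← Set.ncard_eq_toFinset_card, two_mul_ncard_edgeSet h.isMatching, h.ncard_edgeSet] at this

/-- A cycle not in `T` has a vertex outside `coveredSet M T`. -/
lemma mem_of_subset_coveredSet (h : IsGoodMatching M) {T : Finset (Finset V)}
    (hT : ∀ C ∈ T, CycleOn G C) {C : Finset V} (hC : CycleOn G C)
    (hsub : C ⊆ coveredSet M T) : C ∈ T := by
  by_contra hcon
  obtain ⟨z, hz, hzM⟩ := h.exists_notMem_verts hC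
  obtain ⟨D, hD, hzD⟩ := (mem_coveredSet.1 (hsub hz)).resolve_left hzM
  exact Finset.disjoint_left.1 (h.disjoint hC (hT D hD) fun he => hcon (he ▸ hD)) hz hzD

/-- Every permutation contributing to the principal minor on `coveredSet M T` has exactly `#T` odd
cycles, and the lengths being `1` modulo `4` its sign is `(-1) ^ m(G)`. -/
lemma sign_eq (h : IsGoodMatching M) {T : Finset (Finset V)} (hT : ∀ C ∈ T, CycleOn G C)
    {σ : Equiv.Perm V} (hσ : AdjPerm G σ) (hsupp : σ.support = coveredSet M T) :
    Equiv.Perm.sign σ = (-1) ^ matchingNumber G := by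
  have hsub : oddSupports σ ⊆ T := by
    intro S hS
    refine h.mem_of_subset_coveredSet hT (hσ.cycleOn_of_mem_oddSupports hS) ?_
    obtain ⟨τ, hτ, rfl⟩ := Finset.mem_image.1 hS
    rw [← hsupp]
    exact Equiv.Perm.mem_cycleFactorsFinset_support_le (oddFactors_subset σ hτ)
  obtain ⟨M', hM', -, -, hle⟩ := hσ.exists_matching
  have h₁ := ncard_le_matchingNumber hM'
  have h₂ := Finset.card_le_card hsub
  rw [card_oddSupports] at h₂
  rw [hsupp, h.card_coveredSet hT] at hle
  obtain ⟨k, hk, hcard⟩ := sign_and_card_support (σ := σ) fun τ hτ hodd => by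
    by_contra h2
    have := h.card_mod_four (hσ.cycleOn_of_card_ne_two hτ h2)
    exact hodd (Nat.odd_iff.2 (by omega))
  have hsum : ∑ τ ∈ oddFactors σ, τ.support.card =
      4 * ∑ τ ∈ oddFactors σ, τ.support.card / 4 + (oddFactors σ).card := by
    rw [Finset.mul_sum, Finset.card_eq_sum_ones, ← Finset.sum_add_distrib]
    refine Finset.sum_congr rfl fun τ hτ => ?_
    have := h.card_mod_four (hσ.cycleOn_of_mem_oddFactors hτ)
    omega
  rw [hsupp, h.card_coveredSet hT, hsum] at hcard
  have : matchingNumber G = k + 2 * ∑ τ ∈ oddFactors σ, τ.support.card / 4 := by omega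
  rw [hk, this, pow_add, pow_mul, neg_one_sq, one_pow, mul_one]

lemma det_pos (h : IsGoodMatching M) {T : Finset (Finset V)} (hT : ∀ C ∈ T, CycleOn G C) :
    0 < (principalBlock (realAdjMatrix G) (coveredSet M T)).det * (-1) ^ matchingNumber G := by
  obtain ⟨σ, hσ, hsupp, -⟩ := h.exists_adjPerm hT
  exact det_principalBlock_mul_pos (fun _ hσ' hs => h.sign_eq hT hσ' hs) ⟨σ, hσ, hsupp⟩

/-- The negative index of the block on `coveredSet M T` is at most `m(G)`. The vertices of `M`
induce a forest, and each further cycle enlarges the block by a single vertex, without changing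
the sign of the minor. -/
lemma posIdx_neg_le (h : IsGoodMatching M) {T : Finset (Finset V)}
    (hT : ∀ C ∈ T, CycleOn G C) :
    posIdx (-principalBlock (realAdjMatrix G) (coveredSet M T)) ≤ matchingNumber G := by
  induction T using Finset.induction_on with
  | empty =>
    let H : SimpleGraph V := ((⊤ : G.Subgraph).induce (coveredSet M ∅ : Set V)).spanningCoe
    have hH : ∀ a b, H.Adj a b ↔ G.Adj a b ∧ a ∈ coveredSet M ∅ ∧ b ∈ coveredSet M ∅ := by
      intro a b
      simp only [H, Subgraph.spanningCoe_adj, Subgraph.induce_adj, Subgraph.top_adj,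
        Finset.mem_coe]
      tauto
    have hle : H ≤ G := fun a b hab => ((hH a b).1 hab).1
    have hac : H.IsAcyclic := by
      intro u w hw
      have hC : CycleOn G w.support.toFinset := by
        refine ⟨u, w.mapLe hle, hw.mapLe hle, fun x => ?_⟩
        rw [List.mem_toFinset, Walk.support_mapLe_eq_support]
      refine absurd (h.mem_of_subset_coveredSet (T := ∅) (by simp) hC ?_) (by simp)
      intro x hx
      obtain ⟨d, hd⟩ := exists_mem_edges_of_mem_support hw (List.mem_toFinset.1 hx)
      exact ((hH x d).1 (w.adj_of_mem_edges hd)).2.1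
    calc posIdx (-principalBlock (realAdjMatrix G) (coveredSet M ∅))
        ≤ posIdx (-realAdjMatrix H) := posIdx_neg_principalBlock_le_induced hH
      _ = posIdx (realAdjMatrix H) := posIdx_neg_eq_of_isAcyclic hac
      _ ≤ matchingNumber H := posIdx_le_matchingNumber_of_isAcyclic hac
      _ ≤ matchingNumber G := matchingNumber_mono hle
  | insert C T hC ih =>
    have hT' : ∀ C ∈ T, CycleOn G C := fun D hD => hT D (Finset.mem_insert_of_mem hD)
    have hsub : coveredSet M T ⊆ coveredSet M (insert C T) :=
      Finset.union_subset_union_right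
        (Finset.biUnion_subset_biUnion_of_subset_left _ (Finset.subset_insert _ _))
    obtain ⟨z, -, hz⟩ := Finset.exists_eq_insert_iff.2 ⟨hsub, by
      rw [h.card_coveredSet hT, h.card_coveredSet hT', Finset.card_insert_of_notMem hC]
      omega⟩
    have hdet := h.det_pos hT
    rw [← hz] at hdet ⊢
    exact posIdx_neg_principalBlock_insert_le (realAdjMatrix_isHermitian G) (h.det_pos hT') hdet
      (ih hT')

theorem extremal (h : IsGoodMatching M)
    (hd : ∀ C₁ C₂ : G.Subgraph, IsCycleOf G C₁ → IsCycleOf G C₂ → C₁ ≠ C₂ →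
      Disjoint C₁.verts C₂.verts) : Extremal G := by
  classical
  let T : Finset (Finset V) := Finset.univ.filter (CycleOn G)
  have hT : ∀ C ∈ T, CycleOn G C := fun C hC => (Finset.mem_filter.1 hC).2
  have hcyc : {C : G.Subgraph | IsCycleOf G C}.ncard ≤ T.card := by
    rw [← Set.ncard_coe_finset]
    refine Set.ncard_le_ncard_of_injOn (fun C => (Set.toFinite C.verts).toFinset) ?_ ?_
      (Set.toFinite _)
    · intro C hC
      obtain ⟨S, hS, hCS⟩ := cycleOn_of_isCycleOf hC
      have : (Set.toFinite C.verts).toFinset = S := by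
        ext x
        rw [Set.Finite.mem_toFinset, hCS, Finset.mem_coe]
      change (Set.toFinite C.verts).toFinset ∈ (T : Set (Finset V))
      rw [this]
      simpa [T] using hS
    · intro C hC D hD he
      by_contra hne
      have hdis := hd C D hC hD hne
      rw [Set.Finite.toFinset_inj] at he
      rw [he, disjoint_self, Set.bot_eq_empty] at hdis
      obtain ⟨u, w, -, rfl⟩ := hD
      have : u ∈ w.toSubgraph.verts := w.start_mem_verts_toSubgraph
      rw [hdis] at this
      exact this
  have h₁ := cyclomaticNumber_le_ncard_cycles (G := G)
  have h₂ := h.posIdx_neg_le hT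
  have h₃ := posIdx_principalBlock_le (realAdjMatrix G) (coveredSet M T)
  have h₄ := posIdx_add_posIdx_neg_principalBlock (G := G) (S := coveredSet M T) (by
    rintro h0
    have := h.det_pos hT
    simp [h0] at this)
  have h₅ := (coveredSet M T).card_add_card_compl
  have h₆ := h.card_coveredSet hT
  have h₇ := posIdx_le_matchingNumber_add_cyclomaticNumber G
  unfold Extremal
  omega

end IsGoodMatching

end GraphInertia

theorem theorem4p8 {V : Type*} [Fintype V] [DecidableEq V] (G : SimpleGraph V)
    [DecidableRel G.Adj] :
    (GraphInertia.posInertia G : ℤ) =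
        (GraphInertia.matchingNumber G : ℤ) + GraphInertia.cyclomaticNumber G ↔
      (∀ C₁ C₂ : G.Subgraph, GraphInertia.IsCycleOf G C₁ → GraphInertia.IsCycleOf G C₂ →
          C₁ ≠ C₂ → Disjoint C₁.verts C₂.verts) ∧
      (∀ C : G.Subgraph, GraphInertia.IsCycleOf G C → C.verts.ncard % 4 = 1) ∧
      (∃ M : G.Subgraph, GraphInertia.IsMaximumMatching M ∧
          Disjoint M.edgeSet (GraphInertia.cycleLeavingEdges G)) := by
  rw [GraphInertia.posInertia_eq_posIdx]
  constructor
  · intro h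
    have hG : GraphInertia.Extremal G := h
    refine ⟨fun _ _ => hG.disjoint_cycles, fun C hC => ?_, hG.exists_matching⟩
    obtain ⟨S, hS, hCS⟩ := GraphInertia.cycleOn_of_isCycleOf hC
    rw [hCS, Set.ncard_coe_finset]
    exact hG.card_mod_four hS
  · rintro ⟨hd, hmod, M, hM, hF⟩
    obtain ⟨hM₁, hM₂⟩ := GraphInertia.isMaximumMatching_iff.1 hM
    have hgood : GraphInertia.IsGoodMatching M := by
      refine ⟨GraphInertia.disjoint_of_cycleOn hd, fun {C} hC => ?_, hM₁, hM₂,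
        fun {C} hC x y hx hxy => ?_⟩
      · obtain ⟨D, hD, hDC⟩ := hC.exists_isCycleOf
        have := hmod D hD
        rwa [hDC, Set.ncard_coe_finset] at this
      · by_contra hy
        obtain ⟨D, hD, hDC⟩ := hC.exists_isCycleOf
        refine Set.disjoint_left.1 hF (SimpleGraph.Subgraph.mem_edgeSet.2 hxy)
          ⟨hxy.adj_sub, D, hD, x, ?_, y, ?_, rfl⟩ <;> rw [hDC]
        · exact hx
        · exact hy
    exact hgood.extremal hd
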